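/- Let $Q$ be an acyclic quiver of type $ADE$, that is, a finite quiver without oriented cycles whose underlying graph is a Dynkin diagram $A_n$ ($n\ge 1$), $D_n$ ($n\ge 4$), $E_6$, $E_7$ or $E_8$. Let $n$ be the number of its vertices and let $k$ be an algebraically closed field. Let $(a_{ij})$ be the Cartan matrix of $Q$: $a_{ii}=2$, and for $i\ne j$, $-a_{ij}$ is the number of arrows between $i$ and $j$. Let $\Delta_Q$ be the root system of the Kac–Moody algebra of this matrix, with simple roots $\alpha_i$ and simple reflections $s_i(\alpha_j)=\alpha_j-a_{ij}\alpha_i$, and let $\Delta_Q^+$ be the set of its positive roots. The real Schur roots of $Q$ are the dimension vectors of the finite-dimensional indecomposable representations $M$ of $Q$ over $k$ that are exceptional, i.e. $\operatorname{Ext}^1(M,M)=0$; a dimension vector $(d_i)$ is identified with $\sum_i d_i\alpha_i$. Let $P_Q$ be the set of bijections $\pi$ from $\{1,\dots,n\}$ to the set of vertices such that $a<b$ whenever there is an arrow $\pi(a)\to\pi(b)$. In $H=\mathbb R\times\mathbb R_{\ge 0}$ let $p_i=(i,1)$ and $\rho_i=\{(i,y): y\ge 1\}$ for $1\le i\le n$,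 let $P=\{p_1,\dots,p_n\}$ and $b=(0,0)$. An admissible curve is a smooth map $\gamma:[0,1]\to H$ such that (a) $\gamma(0)\in P$ and $\gamma(1)=b$; (b) $\gamma(x)\in\{b\}\cup P$ only for $x\in\{0,1\}$; (c) for each $i$, if $\gamma((0,1])\cap\rho_i\neq\varnothing$, then $\gamma$ and $\rho_i$ intersect transversely (at every $x\in[0,1]$ with $\gamma(x)\in\rho_i$, including $x=0$). It is non-self-crossing if it is injective. Let $\Gamma$ be the set of all non-self-crossing admissible curves. For a bijection $\pi$ as above and $\gamma\in\Gamma$ with $\gamma(0)=p_{k_0}$ that meets, as $x$ increases over $(0,1]$, the rays $\rho_{k_1},\rho_{k_2},\dots,\rho_{k_m}$ in this order, put $\beta=s_{\pi(k_m)}\cdots s_{\pi(k_2)}s_{\pi(k_1)}\alpha_{\pi(k_0)}$. The associated root $\alpha_\pi(\gamma)$ is $\beta$ if $\beta$ is positive and $-\beta$ if $\beta$ is negative. Then $$\bigcup_{\pi\in P_Q}\{\alpha_\pi(\gamma) : \gamma\in\Gamma\}=\{\text{real Schur roots of }Q\}=\Delta_Q^+ .$$ -/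

import Mathlib

open CategoryTheory Set
open scoped ContDiff

universe u v w

namespace LeeLee

/-! ### Acyclic quivers and their Cartan matrices -/

/-- A quiver is acyclic when it has no oriented cycle, that is, every path from a vertex to itself
is trivial. -/
def IsAcyclic (V : Type u) [Quiver.{v} V] : Prop :=
  ∀ (i : V) (p : Quiver.Path i i), p.length = 0

/-- The exchange matrix: number of arrows `i → j` minus number of arrows `j → i` (for a quiver
without oriented 2-cycles at most one of the two numbers is nonzero). -/
noncomputable def exchangeMatrix (V : Type u) [Quiver.{v} V] : Matrix V V ℤ :=
  Matrix.of fun i j => (Nat.card (i ⟶ j) : ℤ) - (Nat.card (j ⟶ i) : ℤ)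

/-- The generalized Cartan matrix of a quiver: `2` on the diagonal, `-|b i j|` off it. -/
noncomputable def cartan (V : Type u) [DecidableEq V] [Quiver.{v} V] : Matrix V V ℤ :=
  Matrix.of fun i j => if i = j then 2 else -|exchangeMatrix V i j|

/-- The quiver is of type `ADE`: for some numbering of its vertices its Cartan matrix is the one of
type `A_n` (`n ≥ 1`), `D_n` (`n ≥ 4`), `E_6`, `E_7` or `E_8`. -/
def IsTypeADE (V : Type u) [DecidableEq V] [Quiver.{v} V] : Prop :=
  (∃ n : ℕ, 1 ≤ n ∧ ∃ e : V ≃ Fin n, (cartan V).reindex e e = CartanMatrix.A n) ∨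
  (∃ n : ℕ, 4 ≤ n ∧ ∃ e : V ≃ Fin n, (cartan V).reindex e e = CartanMatrix.D n) ∨
  (∃ e : V ≃ Fin 6, (cartan V).reindex e e = CartanMatrix.E₆) ∨
  (∃ e : V ≃ Fin 7, (cartan V).reindex e e = CartanMatrix.E₇) ∨
  (∃ e : V ≃ Fin 8, (cartan V).reindex e e = CartanMatrix.E₈)

/-! ### The root system

Elements of the root lattice are written as coefficient vectors `V → ℤ` in the simple roots. -/

section Roots

variable {V : Type u} [DecidableEq V]

/-- The simple root at the vertex `i`. -/
def simpleRoot (i : V) : V → ℤ := Pi.single i 1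

variable [Fintype V]

/-- The simple reflection `s_i`, the linear map with `s_i (α_j) = α_j - a_ij α_i`. -/
def simpleReflection (C : Matrix V V ℤ) (i : V) (x : V → ℤ) : V → ℤ :=
  x - (C.mulVec x i) • simpleRoot i

/-- Real roots: the images of the simple roots under the Weyl group, which is generated by the
simple reflections. -/
inductive IsRealRoot (C : Matrix V V ℤ) : (V → ℤ) → Prop
  | simple (i : V) : IsRealRoot C (simpleRoot i)
  | reflect (i : V) (x : V → ℤ) : IsRealRoot C x → IsRealRoot C (simpleReflection C i x)

/-- Kac's fundamental set: nonzero, nonnegative vectors with connected support in the diagram of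
`C`, whose pairing with every simple coroot is at most `0`. -/
def IsFundamental (C : Matrix V V ℤ) (x : V → ℤ) : Prop :=
  0 ≤ x ∧ x ≠ 0 ∧ (∀ i, C.mulVec x i ≤ 0) ∧
    ((SimpleGraph.fromRel fun i j => C i j ≠ 0).induce {i | x i ≠ 0}).Connected

/-- Imaginary roots: the images under the Weyl group of the vectors of the fundamental set and of
their negatives. -/
inductive IsImaginaryRoot (C : Matrix V V ℤ) : (V → ℤ) → Prop
  | pos (x : V → ℤ) : IsFundamental C x → IsImaginaryRoot C x
  | neg (x : V → ℤ) : IsFundamental C x → IsImaginaryRoot C (-x)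
  | reflect (i : V) (x : V → ℤ) :
      IsImaginaryRoot C x → IsImaginaryRoot C (simpleReflection C i x)

end Roots

/-- The root system of a quiver, that is of the Kac-Moody algebra of its Cartan matrix: real and
imaginary roots. (In type `ADE` there are no imaginary roots.) -/
def rootSystem (V : Type u) [DecidableEq V] [Fintype V] [Quiver.{v} V] : Set (V → ℤ) :=
  {x | IsRealRoot (cartan V) x ∨ IsImaginaryRoot (cartan V) x}

/-- The positive roots: those with nonnegative coefficients. -/
def positiveRoots (V : Type u) [DecidableEq V] [Fintype V] [Quiver.{v} V] : Set (V → ℤ) :=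
  {x | x ∈ rootSystem V ∧ 0 ≤ x}

/-! ### Real Schur roots -/

/-- Representations of the quiver over `k`: a functor on the path category is the same as a vector
space for every vertex and a linear map for every arrow. They are the modules over the path
algebra. -/
abbrev QuiverRep (k : Type w) [Field k] (V : Type u) [Quiver.{v} V] :=
  Paths V ⥤ ModuleCat.{w} k

section Reps

variable {k : Type w} [Field k] {V : Type u} [Quiver.{v} V]

/-- All the vector spaces of the representation are finite-dimensional. -/
def IsFiniteDimensional (M : QuiverRep k V) : Prop :=
  ∀ i : V, Module.Finite k (M.obj ((Paths.of V).obj i))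

/-- The dimension vector. -/
noncomputable def dimensionVector (M : QuiverRep k V) : V → ℤ :=
  fun i => (Module.finrank k (M.obj ((Paths.of V).obj i)) : ℤ)

/-- `M` has no self-extensions: `Ext¹(M, M) = 0` in the abelian category of representations. -/
def IsExceptional (M : QuiverRep k V) : Prop :=
  haveI := HasExt.standard (QuiverRep k V)
  Subsingleton (Abelian.Ext M M 1)

end Reps

/-- Real Schur roots: the dimension vectors of the indecomposable exceptional (finite-dimensional)
representations. -/
def realSchurRoots (k : Type w) [Field k] (V : Type u) [Quiver.{v} V] : Set (V → ℤ) :=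
  {x | ∃ M : QuiverRep k V, IsFiniteDimensional M ∧ Indecomposable M ∧ IsExceptional M ∧
    dimensionVector M = x}

/-! ### Admissible curves

The marked points and rays with indices `1, …, n` are indexed by `Fin n`. A curve `[0,1] → H` is
given by a function `ℝ → ℝ × ℝ`, of which only the values on `[0,1]` are used. -/

/-- The closed upper half plane `H`. -/
def halfPlane : Set (ℝ × ℝ) := {q | 0 ≤ q.2}

/-- The marked points `(1,1), …, (n,1)`. -/
def markedPoint {n : ℕ} (i : Fin n) : ℝ × ℝ := ((i : ℝ) + 1, 1)

/-- The vertical ray that goes up from a marked point. -/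
def ray {n : ℕ} (i : Fin n) : Set (ℝ × ℝ) := {q | q.1 = (i : ℝ) + 1 ∧ 1 ≤ q.2}

/-- The base point. -/
def basePoint : ℝ × ℝ := (0, 0)

/-- Admissible curves. In the transversality clause, the velocity of `γ` at a time when it is on the
vertical ray must not be vertical (or zero), that is, its first coordinate must not vanish. -/
structure IsAdmissible (n : ℕ) (γ : ℝ → ℝ × ℝ) : Prop where
  smooth : ContDiffOn ℝ ∞ γ (Icc 0 1)
  mapsTo : MapsTo γ (Icc 0 1) halfPlane
  start : ∃ i : Fin n, γ 0 = markedPoint i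
  finish : γ 1 = basePoint
  interior : ∀ t ∈ Icc (0 : ℝ) 1,
    (γ t = basePoint ∨ ∃ i : Fin n, γ t = markedPoint i) → t = 0 ∨ t = 1
  transverse : ∀ i : Fin n, (∃ t ∈ Ioc (0 : ℝ) 1, γ t ∈ ray i) →
    ∀ t ∈ Icc (0 : ℝ) 1, γ t ∈ ray i → (derivWithin γ (Icc 0 1) t).1 ≠ 0

/-- The non-self-crossing admissible curves. -/
def nonSelfCrossingCurves (n : ℕ) : Set (ℝ → ℝ × ℝ) :=
  {γ | IsAdmissible n γ ∧ InjOn γ (Icc 0 1)}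

/-- `w` is the list of (indices of) the rays that `γ` crosses at times in `(0,1]`, in the order in
which they are crossed; `ts` is the increasing list of all the crossing times. -/
def IsCrossingWord {n : ℕ} (γ : ℝ → ℝ × ℝ) (w : List (Fin n)) : Prop :=
  ∃ ts : List ℝ, ts.SortedLT ∧ (∀ t, t ∈ ts ↔ t ∈ Ioc (0 : ℝ) 1 ∧ ∃ i : Fin n, γ t ∈ ray i) ∧
    List.Forall₂ (fun t i => γ t ∈ ray i) ts w

/-! ### Associated roots -/

section Associated

variable {V : Type u} [DecidableEq V] [Fintype V] [Quiver.{v} V] {n : ℕ}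

/-- `s_{π(k_m)} ⋯ s_{π(k_1)} α_{π(k₀)}` for the word `w = [k_1, …, k_m]`. -/
noncomputable def wordRoot (π : Fin n ≃ V) (k₀ : Fin n) (w : List (Fin n)) : V → ℤ :=
  w.foldl (fun x k => simpleReflection (cartan V) (π k) x) (simpleRoot (π k₀))

/-- `α` is the associated root of `γ` with respect to `π`: with `k₀` the index of the starting point
of `γ` and `w` its word, it is `wordRoot π k₀ w` if that is positive, and the negative of it
otherwise. -/
def IsAssociatedRoot (π : Fin n ≃ V) (γ : ℝ → ℝ × ℝ) (α : V → ℤ) : Prop :=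
  ∃ (k₀ : Fin n) (w : List (Fin n)), γ 0 = markedPoint k₀ ∧ IsCrossingWord γ w ∧
    ((0 ≤ wordRoot π k₀ w ∧ α = wordRoot π k₀ w) ∨
      (¬ 0 ≤ wordRoot π k₀ w ∧ α = -wordRoot π k₀ w))

end Associated

/-- The orderings `π(1), …, π(n)` of the vertices in which every arrow goes from an earlier to a
later vertex. -/
def admissibleOrderings (V : Type u) [Fintype V] [Quiver.{v} V] :
    Set (Fin (Fintype.card V) ≃ V) :=
  {π | ∀ a b, Nonempty (π a ⟶ π b) → a < b}

end LeeLee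

/-! All three sets are compared with the set of vectors `x ≥ 0` at which the Euler form q(x) =
`eulerForm V x x` equals 1. For an acyclic quiver x·Cx = 2q(x), and in type ADE this form is
positive definite. Hence there are no imaginary roots, and a nonnegative vector with x·Cx = 2
descends through simple reflections to a simple root. So these vectors are exactly the positive
roots (`mem_positiveRoots_iff`).

Curves: simple reflections preserve x·Cx, and an integral vector of norm 2 is nonnegative or
nonpositive, so associated roots are positive roots. For the converse one admissible ordering
suffices. Its Coxeter transformation c has no nonzero fixed vector and permutes the finitely many
roots; the sum over a c-orbit is fixed, hence zero, so some power of c makes a given positive root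
negative. Just before its sign changes under a simple reflection, the root is simple. Read
backwards, each positive root comes from a simple root by a reversed initial segment of the Coxeter
word followed by full reversed words (`exists_coxeter_word`). That is the crossing word of a spiral
that starts at a marked point, passes over the points to its left and then winds around all of them;
`exists_spiral_curve` gives such a curve by a formula.

Representations: this is Gabriel's theorem, proved without reflection functors. Hom and Ext¹ are the
kernel and cokernel of `commutatorMap`, so their dimensions differ by the Euler form. Over an
algebraically closed field induction on the dimension shows that indecomposables have only scalar
endomorphisms (`scalar_of_surjective_summands`); then 0 < q ≤ dim End = 1 yields q = 1 and Ext¹ = 0.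
Conversely, if q(d) = 1, a representation of dimension vector d with the fewest endomorphisms has no
extensions between complementary summands, so a proper decomposition would force q(d) ≥ 2
(`isIndecomposableRep_of_minimal`). Finally `subsingleton_ext_of_surjective` transfers the vanishing
of the cokernel to `Ext` in the functor category. -/

namespace LeeLee

/-! ### Positive definiteness of the ADE Cartan matrices. -/

/-- An integral matrix is anisotropic-positive: its quadratic form is positive off zero. -/
def IsPositive {ι : Type*} [Fintype ι] (C : Matrix ι ι ℤ) : Prop :=
  ∀ x : ι → ℤ, x ⬝ᵥ C.mulVec x ≤ 0 → x = 0

/-- Adding a vertex joined only to the first one to a positive form dominating the square of the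
first coordinate yields a form with the same properties. -/
theorem positive_of_cons {n : ℕ} {C : Matrix (Fin (n + 1)) (Fin (n + 1)) ℤ}
    {C' : Matrix (Fin (n + 2)) (Fin (n + 2)) ℤ}
    (h00 : C' 0 0 = 2) (h01 : C' 0 1 = -1) (h10 : C' 1 0 = -1)
    (h0 : ∀ i : Fin n, C' 0 i.succ.succ = 0) (h0' : ∀ i : Fin n, C' i.succ.succ 0 = 0)
    (hs : ∀ i j : Fin (n + 1), C' i.succ j.succ = C i j)
    (hC : IsPositive C) (hge : ∀ x, x 0 ^ 2 ≤ x ⬝ᵥ C.mulVec x) :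
    IsPositive C' ∧ ∀ x, x 0 ^ 2 ≤ x ⬝ᵥ C'.mulVec x := by
  have key : ∀ x : Fin (n + 2) → ℤ, x ⬝ᵥ C'.mulVec x =
      2 * x 0 ^ 2 - 2 * x 0 * x 1 + (Fin.tail x) ⬝ᵥ C.mulVec (Fin.tail x) := by
    intro x
    have e : ∀ i : Fin (n + 1), C'.mulVec x i.succ = C' i.succ 0 * x 0 +
        C.mulVec (Fin.tail x) i := by
      intro i
      simp [Matrix.mulVec, dotProduct, Fin.sum_univ_succ (n := n + 1), hs, Fin.tail]
    have e0 : C'.mulVec x 0 = 2 * x 0 - x 1 := by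
      simp [Matrix.mulVec, dotProduct, Fin.sum_univ_succ, h00, h01, h0]; ring
    rw [dotProduct, Fin.sum_univ_succ, e0]
    simp only [e, mul_add, Finset.sum_add_distrib]
    rw [Fin.sum_univ_succ (n := n)]
    simp [h0', h10, dotProduct, Fin.tail]
    ring
  have t0 : ∀ x : Fin (n + 2) → ℤ, Fin.tail x 0 = x 1 := fun x => rfl
  refine ⟨fun x hx => ?_, fun x => ?_⟩
  · rw [key] at hx
    have h1 := hge (Fin.tail x)
    rw [t0] at h1
    -- The new form is `x 0 ^ 2 + (x 0 - x 1) ^ 2` plus the excess of the old form over `x 1 ^ 2`,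
    -- which is nonnegative.
    have hx0 : x 0 = 0 := by nlinarith [sq_nonneg (x 0 - x 1), sq_nonneg (x 0)]
    have htl : Fin.tail x = 0 := hC _ (by rw [hx0] at hx; linarith)
    funext i
    refine Fin.cases hx0 (fun j => ?_) i
    exact congrFun htl j
  · rw [key]
    have h1 := hge (Fin.tail x)
    rw [t0] at h1
    nlinarith [sq_nonneg (x 0 - x 1)]

theorem positive_A (n : ℕ) :
    IsPositive (CartanMatrix.A (n + 1)) ∧
      ∀ x, x 0 ^ 2 ≤ x ⬝ᵥ (CartanMatrix.A (n + 1)).mulVec x := by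
  induction n with
  | zero =>
    change IsPositive (CartanMatrix.A 1) ∧
      ∀ x : Fin 1 → ℤ, x 0 ^ 2 ≤ x ⬝ᵥ (CartanMatrix.A 1).mulVec x
    refine ⟨fun x hx => ?_, fun x => ?_⟩
    · simp [Matrix.mulVec, dotProduct, CartanMatrix.A] at hx
      funext i
      rw [Subsingleton.elim i 0]
      simp only [Pi.zero_apply]
      nlinarith
    · simp [Matrix.mulVec, dotProduct, CartanMatrix.A]
      nlinarith [sq_nonneg (x 0)]
  | succ n ih =>
    refine positive_of_cons (C := CartanMatrix.A (n + 1)) ?_ ?_ ?_ ?_ ?_ ?_ ih.1 ih.2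
    · simp [CartanMatrix.A]
    · simp [CartanMatrix.A]
    · simp [CartanMatrix.A]
    · intro i; simp [CartanMatrix.A, Fin.ext_iff]
    · intro i; simp [CartanMatrix.A, Fin.ext_iff]
    · intro i j; simp [CartanMatrix.A, Fin.ext_iff]

/-- The induction starts at `D 3`, a path whose middle vertex has number 0. The tail then grows at
vertex 0, as in type A, while the fork stays at the far end. -/
theorem positive_D (n : ℕ) :
    IsPositive (CartanMatrix.D (n + 3)) ∧
      ∀ x, x 0 ^ 2 ≤ x ⬝ᵥ (CartanMatrix.D (n + 3)).mulVec x := by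
  induction n with
  | zero =>
    change IsPositive (CartanMatrix.D 3) ∧
      ∀ x : Fin 3 → ℤ, x 0 ^ 2 ≤ x ⬝ᵥ (CartanMatrix.D 3).mulVec x
    have key : ∀ x : Fin 3 → ℤ, x ⬝ᵥ (CartanMatrix.D 3).mulVec x =
        2 * x 0 ^ 2 + 2 * x 1 ^ 2 + 2 * x 2 ^ 2 - 2 * x 0 * x 1 - 2 * x 0 * x 2 := by
      intro x
      rw [CartanMatrix.D_three]
      simp [Matrix.mulVec, dotProduct, Fin.sum_univ_succ]
      ring
    refine ⟨fun x hx => ?_, fun x => ?_⟩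
    · rw [key] at hx
      have h0 : x 0 = 0 := by
        nlinarith [sq_nonneg (x 0 - 2 * x 1), sq_nonneg (x 0 - 2 * x 2), sq_nonneg (x 0)]
      rw [h0] at hx
      have h1 : x 1 = 0 := by nlinarith [sq_nonneg (x 1), sq_nonneg (x 2)]
      have h2 : x 2 = 0 := by nlinarith [sq_nonneg (x 1), sq_nonneg (x 2)]
      funext i
      fin_cases i
      exacts [h0, h1, h2]
    · rw [key]
      nlinarith [sq_nonneg (x 0 - 2 * x 1), sq_nonneg (x 0 - 2 * x 2)]
  | succ n ih =>
    refine positive_of_cons (C := CartanMatrix.D (n + 3)) ?_ ?_ ?_ ?_ ?_ ?_ ih.1 ih.2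
    · simp [CartanMatrix.D]
    · simp [CartanMatrix.D]
    · simp [CartanMatrix.D]
    · intro i
      have := i.2
      simp only [CartanMatrix.D, Matrix.of_apply, Fin.ext_iff, Fin.val_succ, Fin.val_zero]
      split_ifs <;> first | omega | simp_all
    · intro i
      have := i.2
      simp only [CartanMatrix.D, Matrix.of_apply, Fin.ext_iff, Fin.val_succ, Fin.val_zero]
      split_ifs <;> first | omega | simp_all
    · intro i j; simp [CartanMatrix.D, Fin.ext_iff]

/-- Squares are completed from the tips of the three arms (of 1, 2 and 4 vertices) towards the
branch vertex `d`. What remains is (2 - 1/2 - 2/3 - 4/5) d² = d²/30; the factor 60 clears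
denominators. -/
theorem eight_form_anisotropic {a b c d e f g h : ℤ}
    (hx : 2 * (a ^ 2 + b ^ 2 + c ^ 2 + d ^ 2 + e ^ 2 + f ^ 2 + g ^ 2 + h ^ 2
      - a * c - b * d - c * d - d * e - e * f - f * g - g * h) ≤ 0) :
    a = 0 ∧ b = 0 ∧ c = 0 ∧ d = 0 ∧ e = 0 ∧ f = 0 ∧ g = 0 ∧ h = 0 := by
  have key : 60 * (2 * (a ^ 2 + b ^ 2 + c ^ 2 + d ^ 2 + e ^ 2 + f ^ 2 + g ^ 2 + h ^ 2
      - a * c - b * d - c * d - d * e - e * f - f * g - g * h)) =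
      30 * (2 * b - d) ^ 2 + 30 * (2 * a - c) ^ 2 + 10 * (3 * c - 2 * d) ^ 2
      + 30 * (2 * h - g) ^ 2 + 10 * (3 * g - 2 * f) ^ 2 + 5 * (4 * f - 3 * e) ^ 2
      + 3 * (5 * e - 4 * d) ^ 2 + 2 * d ^ 2 := by ring
  have p1 := sq_nonneg (2 * b - d)
  have p2 := sq_nonneg (2 * a - c)
  have p3 := sq_nonneg (3 * c - 2 * d)
  have p4 := sq_nonneg (2 * h - g)
  have p5 := sq_nonneg (3 * g - 2 * f)
  have p6 := sq_nonneg (4 * f - 3 * e)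
  have p7 := sq_nonneg (5 * e - 4 * d)
  have p8 := sq_nonneg d
  have hd : d = 0 := pow_eq_zero_iff (two_ne_zero) |>.1 (by linarith : d ^ 2 = 0)
  have hb := pow_eq_zero_iff (two_ne_zero) |>.1 (by linarith : (2 * b - d) ^ 2 = 0)
  have ha := pow_eq_zero_iff (two_ne_zero) |>.1 (by linarith : (2 * a - c) ^ 2 = 0)
  have hc := pow_eq_zero_iff (two_ne_zero) |>.1 (by linarith : (3 * c - 2 * d) ^ 2 = 0)
  have hh := pow_eq_zero_iff (two_ne_zero) |>.1 (by linarith : (2 * h - g) ^ 2 = 0)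
  have hg := pow_eq_zero_iff (two_ne_zero) |>.1 (by linarith : (3 * g - 2 * f) ^ 2 = 0)
  have hf := pow_eq_zero_iff (two_ne_zero) |>.1 (by linarith : (4 * f - 3 * e) ^ 2 = 0)
  have he := pow_eq_zero_iff (two_ne_zero) |>.1 (by linarith : (5 * e - 4 * d) ^ 2 = 0)
  omega

theorem positive_E₈ : IsPositive CartanMatrix.E₈ := by
  intro x hx
  have := @eight_form_anisotropic (x 0) (x 1) (x 2) (x 3) (x 4) (x 5) (x 6) (x 7) (by
    refine le_of_eq_of_le ?_ hx
    simp [Matrix.mulVec, dotProduct, Fin.sum_univ_succ, CartanMatrix.E₈]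
    ring)
  funext i
  fin_cases i <;> simp [this]

/-- E₇ and E₆ arise from E₈ by deleting vertices at the end of the long arm, so their forms are the
eight-variable form with the last variables set to 0. -/
theorem positive_E₇ : IsPositive CartanMatrix.E₇ := by
  intro x hx
  have := @eight_form_anisotropic (x 0) (x 1) (x 2) (x 3) (x 4) (x 5) (x 6) 0 (by
    refine le_of_eq_of_le ?_ hx
    simp [Matrix.mulVec, dotProduct, Fin.sum_univ_succ, CartanMatrix.E₇]
    ring)
  funext i
  fin_cases i <;> simp [this]

theorem positive_E₆ : IsPositive CartanMatrix.E₆ := by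
  intro x hx
  have := @eight_form_anisotropic (x 0) (x 1) (x 2) (x 3) (x 4) (x 5) 0 0 (by
    refine le_of_eq_of_le ?_ hx
    simp [Matrix.mulVec, dotProduct, Fin.sum_univ_succ, CartanMatrix.E₆]
    ring)
  funext i
  fin_cases i <;> simp [this]

theorem IsPositive.of_reindex {ι κ : Type*} [Fintype ι] [Fintype κ] {C : Matrix ι ι ℤ} (e : ι ≃ κ)
    (h : IsPositive (C.reindex e e)) : IsPositive C := by
  intro x hx
  have := h (x ∘ e.symm) (by
    refine le_of_eq_of_le ?_ hx
    rw [Matrix.reindex_apply, Matrix.submatrix_mulVec_equiv]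
    simp [Function.comp_assoc, dotProduct]
    exact e.symm.sum_comp (fun i => x i * C.mulVec x i))
  funext i
  simpa using congrFun this (e i)

theorem IsTypeADE.positive {V : Type u} [DecidableEq V] [Fintype V] [Quiver.{v} V]
    (h : IsTypeADE V) : IsPositive (cartan V) := by
  rcases h with ⟨n, hn, e, h⟩ | ⟨n, hn, e, h⟩ | ⟨e, h⟩ | ⟨e, h⟩ | ⟨e, h⟩
  · obtain ⟨m, rfl⟩ := Nat.exists_eq_add_of_le' hn
    exact .of_reindex e (h ▸ (positive_A m).1)
  · obtain ⟨m, rfl⟩ := Nat.exists_eq_add_of_le' (show 3 ≤ n by omega)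
    exact .of_reindex e (h ▸ (positive_D m).1)
  · exact .of_reindex e (h ▸ positive_E₆)
  · exact .of_reindex e (h ▸ positive_E₇)
  · exact .of_reindex e (h ▸ positive_E₈)

/-! ### Roots of a finite-type Cartan matrix as vectors of norm 2. -/

/-- The properties of a symmetric Cartan matrix of finite type that are used below. -/
structure IsFiniteCartan {V : Type*} [Fintype V] (C : Matrix V V ℤ) : Prop where
  symm : C.IsSymm
  diag : ∀ i, C i i = 2
  offDiag : ∀ i j, i ≠ j → C i j ≤ 0
  even : ∀ x : V → ℤ, Even (x ⬝ᵥ C.mulVec x)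
  positive : IsPositive C

section

variable {V : Type u} [DecidableEq V] [Fintype V] {C : Matrix V V ℤ}

theorem dotProduct_simpleRoot (x : V → ℤ) (i : V) : simpleRoot i ⬝ᵥ x = x i := by
  simp [simpleRoot]

namespace IsFiniteCartan

omit [DecidableEq V] in
theorem form_comm (h : IsFiniteCartan C) (x y : V → ℤ) :
    x ⬝ᵥ C.mulVec y = y ⬝ᵥ C.mulVec x := by
  rw [Matrix.dotProduct_mulVec, dotProduct_comm, ← Matrix.mulVec_transpose, h.symm.eq]

theorem mulVec_simpleRoot_self (h : IsFiniteCartan C) (i : V) : C.mulVec (simpleRoot i) i = 2 := by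
  simp [simpleRoot, h.diag]

theorem form_simpleRoot (h : IsFiniteCartan C) (i : V) :
    simpleRoot i ⬝ᵥ C.mulVec (simpleRoot i) = 2 := by
  rw [dotProduct_simpleRoot, h.mulVec_simpleRoot_self]

theorem form_add_smul (h : IsFiniteCartan C) (x : V → ℤ) (a : ℤ) (i : V) :
    (x - a • simpleRoot i) ⬝ᵥ C.mulVec (x - a • simpleRoot i) =
      x ⬝ᵥ C.mulVec x - 2 * a * C.mulVec x i + 2 * a ^ 2 := by
  have h1 : x ⬝ᵥ C.mulVec (simpleRoot i) = C.mulVec x i := by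
    rw [h.form_comm, dotProduct_simpleRoot]
  have h2 := h.form_simpleRoot i
  simp only [Matrix.mulVec_sub, Matrix.mulVec_smul, sub_dotProduct, dotProduct_sub,
    smul_dotProduct, dotProduct_smul, h1, h2, dotProduct_simpleRoot, smul_eq_mul]
  ring

theorem form_reflection (h : IsFiniteCartan C) (i : V) (x : V → ℤ) :
    simpleReflection C i x ⬝ᵥ C.mulVec (simpleReflection C i x) = x ⬝ᵥ C.mulVec x := by
  rw [simpleReflection, h.form_add_smul]; ring

theorem reflection_reflection (h : IsFiniteCartan C) (i : V) (x : V → ℤ) :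
    simpleReflection C i (simpleReflection C i x) = x := by
  have : C.mulVec (simpleReflection C i x) i = - C.mulVec x i := by
    simp only [simpleReflection, Matrix.mulVec_sub, Matrix.mulVec_smul, Pi.sub_apply,
      Pi.smul_apply, h.mulVec_simpleRoot_self, smul_eq_mul]
    ring
  rw [simpleReflection, this, simpleReflection]
  simp

omit [DecidableEq V] in
theorem form_pos (h : IsFiniteCartan C) {x : V → ℤ} (hx : x ≠ 0) : 0 < x ⬝ᵥ C.mulVec x := by
  by_contra hc
  exact hx (h.positive x (not_lt.1 hc))

omit [DecidableEq V] in
theorem two_le_form (h : IsFiniteCartan C) {x : V → ℤ} (hx : x ≠ 0) : 2 ≤ x ⬝ᵥ C.mulVec x := by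
  have := h.form_pos hx
  obtain ⟨r, hr⟩ := h.even x
  omega

theorem form_of_isRealRoot (h : IsFiniteCartan C) {x : V → ℤ} (hx : IsRealRoot C x) :
    x ⬝ᵥ C.mulVec x = 2 := by
  induction hx with
  | simple i => exact h.form_simpleRoot i
  | reflect i x _ ih => rw [h.form_reflection, ih]

-- For such a vector every term of x·Cx = ∑ x_i (Cx)_i is at most 0, which positivity forbids.
omit [DecidableEq V] in
theorem not_isFundamental (h : IsFiniteCartan C) {x : V → ℤ} : ¬ IsFundamental C x := by
  rintro ⟨h0, hne, hle, -⟩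
  refine hne (h.positive x ?_)
  exact Finset.sum_nonpos fun i _ => mul_nonpos_of_nonneg_of_nonpos (h0 i) (hle i)

theorem not_isImaginaryRoot (h : IsFiniteCartan C) {x : V → ℤ} : ¬ IsImaginaryRoot C x := by
  intro hx
  induction hx with
  | pos x hx => exact h.not_isFundamental hx
  | neg x hx => exact h.not_isFundamental hx
  | reflect i x _ ih => exact ih

/-- The norm of x - α_i is 4 - 2(Cx)_i, and it is positive. -/
theorem mulVec_le_one (h : IsFiniteCartan C) {x : V → ℤ} (hx : x ⬝ᵥ C.mulVec x = 2) {i : V}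
    (hne : x ≠ simpleRoot i) : C.mulVec x i ≤ 1 := by
  have h1 := h.form_pos (sub_ne_zero.2 hne)
  have h2 := h.form_add_smul x 1 i
  rw [one_smul] at h2
  rw [h2, hx] at h1
  linarith

/-- Descent on the height. As ∑ x_i (Cx)_i = 2, some i has x_i > 0 and (Cx)_i > 0. Unless x is
simple, (Cx)_i = 1, and s_i x = x - α_i is again nonnegative and of smaller height. -/
theorem isRealRoot_of_nonneg (h : IsFiniteCartan C) {x : V → ℤ} (h0 : 0 ≤ x)
    (hx : x ⬝ᵥ C.mulVec x = 2) : IsRealRoot C x := by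
  obtain ⟨N, hN⟩ : ∃ N : ℕ, ∑ i, x i ≤ N := ⟨(∑ i, x i).toNat, Int.self_le_toNat _⟩
  induction N generalizing x with
  | zero =>
    have hs : ∑ i, x i = 0 := le_antisymm (by simpa using hN) (Finset.sum_nonneg fun i _ => h0 i)
    have : x = 0 := by
      funext i
      exact (Finset.sum_eq_zero_iff_of_nonneg fun i _ => h0 i).1 hs i (Finset.mem_univ i)
    simp [this] at hx
  | succ N ih =>
    obtain ⟨i, -, hi⟩ : ∃ i ∈ Finset.univ, 0 < x i * C.mulVec x i := by
      by_contra! hc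
      have : x ⬝ᵥ C.mulVec x ≤ 0 := Finset.sum_nonpos hc
      omega
    have hxi : 0 < x i := lt_of_le_of_ne (h0 i) (fun hc => by simp [← hc] at hi)
    have hci : 0 < C.mulVec x i := by
      by_contra hc
      nlinarith [not_lt.1 hc]
    by_cases hne : x = simpleRoot i
    · exact hne ▸ .simple i
    have h1 : C.mulVec x i = 1 := le_antisymm (h.mulVec_le_one hx hne) hci
    have hs : simpleReflection C i x = x - simpleRoot i := by simp [simpleReflection, h1]
    have := ih (x := simpleReflection C i x) (by
        rw [hs]
        intro j
        by_cases hj : j = i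
        · subst hj; simp [simpleRoot]; omega
        · simpa [simpleRoot, hj] using h0 j)
      (by rw [h.form_reflection, hx]) (by
        rw [hs]
        simp [simpleRoot, Finset.sum_sub_distrib]
        push_cast at hN
        linarith)
    have := IsRealRoot.reflect i _ this
    rwa [h.reflection_reflection] at this

/-- The positive and negative parts have disjoint supports, so their mixed term is at most 0. If
both were nonzero, the norm would be at least 2 + 2. -/
theorem nonneg_or_nonpos (h : IsFiniteCartan C) {x : V → ℤ} (hx : x ⬝ᵥ C.mulVec x = 2) :
    0 ≤ x ∨ x ≤ 0 := by
  have hd : x = x⁺ - x⁻ := (posPart_sub_negPart x).symm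
  have hc : x⁺ ⬝ᵥ C.mulVec x⁻ ≤ 0 := by
    refine Finset.sum_nonpos fun i _ => ?_
    rw [Matrix.mulVec, dotProduct, Finset.mul_sum]
    refine Finset.sum_nonpos fun j _ => ?_
    have hp : 0 ≤ x⁺ i := by simp [Pi.posPart_apply]
    have hn : 0 ≤ x⁻ j := by simp [Pi.negPart_apply]
    by_cases hij : i = j
    · subst hij
      rcases le_total 0 (x i) with hx | hx
      · simp [Pi.negPart_apply, negPart_eq_zero.2 hx]
      · simp [Pi.posPart_apply, posPart_eq_zero.2 hx]
    · exact mul_nonpos_of_nonneg_of_nonpos hp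
        (mul_nonpos_of_nonpos_of_nonneg (h.offDiag i j hij) hn)
  have e : x ⬝ᵥ C.mulVec x =
      x⁺ ⬝ᵥ C.mulVec x⁺ + x⁻ ⬝ᵥ C.mulVec x⁻ - 2 * (x⁺ ⬝ᵥ C.mulVec x⁻) := by
    conv_lhs => rw [hd]
    simp only [Matrix.mulVec_sub, sub_dotProduct, dotProduct_sub]
    rw [h.form_comm x⁻ x⁺]
    ring
  by_contra! hcon
  have h1 : x⁺ ≠ 0 := fun h0 => hcon.2 (by rwa [posPart_eq_zero] at h0)
  have h2 : x⁻ ≠ 0 := fun h0 => hcon.1 (by rwa [negPart_eq_zero] at h0)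
  have := h.two_le_form h1
  have := h.two_le_form h2
  omega

/-- A simple reflection alters only the coordinate i. If the result is nonpositive, all other
coordinates of x vanish, and x = c α_i has norm 2c². -/
theorem eq_simpleRoot (h : IsFiniteCartan C) {x : V → ℤ} (h0 : 0 ≤ x)
    (hx : x ⬝ᵥ C.mulVec x = 2) {i : V} (hi : ¬ 0 ≤ simpleReflection C i x) :
    x = simpleRoot i := by
  have hle := (h.nonneg_or_nonpos ((h.form_reflection i x).trans hx)).resolve_left hi
  have hz : ∀ j, j ≠ i → x j = 0 := by
    intro j hj
    have := hle j
    simp [simpleReflection, simpleRoot, hj] at this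
    exact le_antisymm this (h0 j)
  have he : x = x i • simpleRoot i := by
    funext j
    by_cases hj : j = i
    · subst hj; simp [simpleRoot]
    · simp [simpleRoot, hj, hz j hj]
  have h2 : x i * (x i * 2) = 2 := by
    rw [he, Matrix.mulVec_smul, dotProduct_smul, smul_dotProduct, h.form_simpleRoot] at hx
    simpa using hx
  have h3 := h0 i
  simp only [Pi.zero_apply] at h3
  have : x i = 1 := by nlinarith
  rw [he, this, one_smul]

/-- Nonnegativity of the form at x ± α_i bounds each (Cx)_i by 2 in absolute value, and x ↦ Cx is
injective. -/
theorem finite_roots (h : IsFiniteCartan C) : {x : V → ℤ | x ⬝ᵥ C.mulVec x = 2}.Finite := by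
  have hb : ∀ x ∈ {x : V → ℤ | x ⬝ᵥ C.mulVec x = 2},
      C.mulVec x ∈ Icc (fun _ => (-2 : ℤ)) (fun _ => (2 : ℤ)) := by
    have hnn : ∀ y : V → ℤ, 0 ≤ y ⬝ᵥ C.mulVec y := fun y => by
      by_cases hy : y = 0
      · simp [hy]
      · exact (h.form_pos hy).le
    intro x hx
    rw [mem_ofPred_eq] at hx
    refine ⟨fun i => ?_, fun i => ?_⟩
    · have h1 := hnn (x - (-1 : ℤ) • simpleRoot i)
      rw [h.form_add_smul, hx] at h1
      linarith
    · have h1 := hnn (x - (1 : ℤ) • simpleRoot i)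
      rw [h.form_add_smul, hx] at h1
      linarith
  refine Set.Finite.of_finite_image ((Set.finite_Icc _ _).subset (image_subset_iff.2 hb))
    (fun x _ y _ hxy => ?_)
  refine sub_eq_zero.1 (h.positive (x - y) ?_)
  rw [Matrix.mulVec_sub, hxy]
  simp

end IsFiniteCartan

/-! ### Coxeter words. -/

/-- The product of simple reflections along a list, the head acting first. -/
def reflectAlong (C : Matrix V V ℤ) (L : List V) (x : V → ℤ) : V → ℤ :=
  L.foldl (fun x i => simpleReflection C i x) x

@[simp] theorem reflectAlong_cons (i : V) (L : List V) (x : V → ℤ) :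
    reflectAlong C (i :: L) x = reflectAlong C L (simpleReflection C i x) := rfl

theorem reflectAlong_append (L L' : List V) (x : V → ℤ) :
    reflectAlong C (L ++ L') x = reflectAlong C L' (reflectAlong C L x) := by
  simp [reflectAlong]

theorem simpleReflection_add (i : V) (x y : V → ℤ) :
    simpleReflection C i (x + y) = simpleReflection C i x + simpleReflection C i y := by
  simp only [simpleReflection, Matrix.mulVec_add, Pi.add_apply, add_smul]
  abel

/-- The product of simple reflections along a list as an additive map. -/
def reflectHom (C : Matrix V V ℤ) (L : List V) : (V → ℤ) →+ (V → ℤ) where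
  toFun := reflectAlong C L
  map_zero' := by
    induction L with
    | nil => rfl
    | cons i L ih => simpa [simpleReflection] using ih
  map_add' x y := by
    induction L generalizing x y with
    | nil => rfl
    | cons i L ih => simp [simpleReflection_add, ih]

@[simp] theorem reflectHom_apply (L : List V) (x : V → ℤ) :
    reflectHom C L x = reflectAlong C L x := rfl

namespace IsFiniteCartan

theorem form_reflectAlong (h : IsFiniteCartan C) (L : List V) (x : V → ℤ) :
    reflectAlong C L x ⬝ᵥ C.mulVec (reflectAlong C L x) = x ⬝ᵥ C.mulVec x := by
  induction L generalizing x with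
  | nil => rfl
  | cons i L ih => rw [reflectAlong_cons, ih, h.form_reflection]

theorem reflectAlong_reverse (h : IsFiniteCartan C) (L : List V) (x : V → ℤ) :
    reflectAlong C L.reverse (reflectAlong C L x) = x := by
  induction L generalizing x with
  | nil => rfl
  | cons i L ih =>
    rw [List.reverse_cons, reflectAlong_append, reflectAlong_cons i L, ih]
    exact h.reflection_reflection i x

end IsFiniteCartan

theorem reflectAlong_apply_of_notMem {L : List V} {i : V} (hi : i ∉ L) (x : V → ℤ) :
    reflectAlong C L x i = x i := by
  induction L generalizing x with
  | nil => rfl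
  | cons j L ih =>
    rw [List.mem_cons, not_or] at hi
    rw [reflectAlong_cons, ih hi.2]
    simp [simpleReflection, simpleRoot, hi.1]

/-- In a word without repetitions the coordinate at the first letter is touched only by the first
reflection. For a fixed vector this reflection must act trivially, and so on along the word. Thus a
Coxeter transformation fixes only 0. -/
theorem mulVec_eq_zero_of_reflectAlong {L : List V} (hL : L.Nodup) {x : V → ℤ}
    (hx : reflectAlong C L x = x) : ∀ i ∈ L, C.mulVec x i = 0 := by
  induction L with
  | nil => simp
  | cons j L ih =>
    rw [List.nodup_cons] at hL
    have h1 : C.mulVec x j = 0 := by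
      have := congrFun hx j
      rw [reflectAlong_cons, reflectAlong_apply_of_notMem hL.1] at this
      simpa [simpleReflection, simpleRoot] using this
    have h2 : simpleReflection C j x = x := by simp [simpleReflection, h1]
    rw [reflectAlong_cons, h2] at hx
    intro i hi
    rcases List.mem_cons.1 hi with rfl | hi
    · exact h1
    · exact ih hL.2 hx i hi

namespace IsFiniteCartan

/-- Some power of a Coxeter transformation makes a given root nonpositive. -/
theorem exists_iterate_not_nonneg (h : IsFiniteCartan C) {L : List V} (hL : L.Nodup)
    (hmem : ∀ i, i ∈ L) {x : V → ℤ} (hx : x ⬝ᵥ C.mulVec x = 2) :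
    ∃ m : ℕ, ¬ 0 ≤ (reflectAlong C L)^[m] x := by
  by_contra! hc
  have hform : ∀ m : ℕ, (reflectAlong C L)^[m] x ∈ {x : V → ℤ | x ⬝ᵥ C.mulVec x = 2} := by
    intro m
    induction m with
    | zero => exact hx
    | succ m ih =>
      rw [Function.iterate_succ_apply', mem_ofPred_eq, h.form_reflectAlong]
      exact ih
  -- The orbit lies in a finite set and the transformation is injective, so the orbit is periodic.
  obtain ⟨a, -, b, -, hab, he⟩ := Set.infinite_univ.exists_lt_map_eq_of_mapsTo
    (f := fun m : ℕ => (reflectAlong C L)^[m] x) (fun m _ => hform m) h.finite_roots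
  have hinj : Function.Injective (reflectAlong C L) :=
    Function.LeftInverse.injective (h.reflectAlong_reverse L)
  obtain ⟨N, rfl⟩ := Nat.exists_eq_add_of_lt hab
  have hN : (reflectAlong C L)^[N + 1] x = x := by
    simp only [add_assoc, Function.iterate_add_apply _ a] at he
    exact (hinj.iterate a he).symm
  -- The sum over a period is fixed by the Coxeter transformation, hence zero; as a sum of
  -- nonnegative vectors including x, it forces x = 0.
  set S := ∑ m ∈ Finset.range (N + 1), (reflectAlong C L)^[m] x with hS
  have hfix : reflectAlong C L S = S := by
    have : reflectAlong C L S = ∑ m ∈ Finset.range (N + 1), (reflectAlong C L)^[m + 1] x := by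
      rw [← reflectHom_apply, hS, map_sum]
      simp only [reflectHom_apply, Function.iterate_succ_apply']
    rw [this, Finset.sum_range_succ, hN, hS, Finset.sum_range_succ']
    simp
  have hS0 : S = 0 := by
    refine h.positive S (le_of_eq ?_)
    have : C.mulVec S = 0 :=
      funext fun i => mulVec_eq_zero_of_reflectAlong hL hfix i (hmem i)
    simp [this]
  have hx0 : x = 0 := by
    refine le_antisymm ?_ (hc 0)
    calc x = (reflectAlong C L)^[0] x := rfl
      _ ≤ S := Finset.single_le_sum (f := fun m => (reflectAlong C L)^[m] x)
        (fun m _ => hc m) (by simp)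
      _ = 0 := hS0
  simp [hx0] at hx

/-- At the first letter that destroys nonnegativity the current root is the simple root of that
letter, by `eq_simpleRoot`. -/
theorem exists_split_of_not_nonneg (h : IsFiniteCartan C) (L : List V) {x : V → ℤ}
    (hx : x ⬝ᵥ C.mulVec x = 2) (h0 : 0 ≤ x) (hneg : ¬ 0 ≤ reflectAlong C L x) :
    ∃ L₁ i L₂, L = L₁ ++ i :: L₂ ∧ reflectAlong C L₁ x = simpleRoot i := by
  induction L generalizing x with
  | nil => exact absurd h0 hneg
  | cons j L ih =>
    by_cases hj : 0 ≤ simpleReflection C j x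
    · obtain ⟨L₁, i, L₂, rfl, he⟩ := ih ((h.form_reflection j x).trans hx) hj hneg
      exact ⟨j :: L₁, i, L₂, rfl, he⟩
    · exact ⟨[], j, L, rfl, h.eq_simpleRoot h0 hx hj⟩

/-- Every positive root is obtained from a simple root by an initial segment of a Coxeter word
followed by repetitions of the whole word. -/
theorem exists_coxeter_word (h : IsFiniteCartan C) {L : List V} (hL : L.Nodup)
    (hmem : ∀ i, i ∈ L) {x : V → ℤ} (hx : x ⬝ᵥ C.mulVec x = 2) (h0 : 0 ≤ x) :
    ∃ (L₁ : List V) (i : V) (L₂ : List V) (m : ℕ), L = L₁ ++ i :: L₂ ∧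
      x = reflectAlong C (L₁.reverse ++ (List.replicate m L.reverse).flatten) (simpleRoot i) := by
  classical
  have hex := h.exists_iterate_not_nonneg hL hmem hx
  -- With m the first power that destroys nonnegativity, r = m - 1 passes preserve it and the sign
  -- changes during the next pass. Undoing these steps gives the word.
  set m := Nat.find hex with hm
  have hm0 : m ≠ 0 := fun hz => by
    have := Nat.find_spec hex
    rw [← hm, hz] at this
    exact this h0
  obtain ⟨r, hr⟩ := Nat.exists_eq_succ_of_ne_zero hm0
  have hpos : 0 ≤ (reflectAlong C L)^[r] x := by
    by_contra hc
    have := Nat.find_min' hex hc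
    omega
  have hneg : ¬ 0 ≤ reflectAlong C L ((reflectAlong C L)^[r] x) := by
    have := Nat.find_spec hex
    rwa [← hm, hr, Nat.succ_eq_add_one, Function.iterate_succ_apply'] at this
  have key : ∀ (r : ℕ) (y : V → ℤ),
      reflectAlong C (List.replicate r L.reverse).flatten ((reflectAlong C L)^[r] y) = y := by
    intro r
    induction r with
    | zero => intro y; rfl
    | succ r ih =>
      intro y
      rw [Function.iterate_succ_apply', List.replicate_succ, List.flatten_cons,
        reflectAlong_append, h.reflectAlong_reverse, ih]
  have hform : ∀ (r : ℕ), ((reflectAlong C L)^[r] x) ⬝ᵥ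
      C.mulVec ((reflectAlong C L)^[r] x) = 2 := by
    intro r
    induction r with
    | zero => exact hx
    | succ r ih => rw [Function.iterate_succ_apply', h.form_reflectAlong, ih]
  obtain ⟨L₁, i, L₂, he, hi⟩ := h.exists_split_of_not_nonneg L (hform r) hpos hneg
  refine ⟨L₁, i, L₂, r, he, ?_⟩
  rw [reflectAlong_append, ← hi, h.reflectAlong_reverse, key]

end IsFiniteCartan

end

/-! ### Spiral words. -/

/-- The word of a curve that starts at the marked point with index `k`, passes over the marked
points to its left, and then winds `m` times around all of them. -/
def spiralWord {n : ℕ} (k : Fin n) (m : ℕ) : List (Fin n) :=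
  ((List.finRange n).take k).reverse ++ (List.replicate m (List.finRange n).reverse).flatten

section

variable {V : Type u} [DecidableEq V] [Fintype V] [Quiver.{v} V]

theorem wordRoot_eq {n : ℕ} (π : Fin n ≃ V) (k : Fin n) (w : List (Fin n)) :
    wordRoot π k w = reflectAlong (cartan V) (w.map π) (simpleRoot (π k)) := by
  simp [wordRoot, reflectAlong, List.foldl_map]

/-- This is `exists_coxeter_word` for the word π(1), …, π(n): the number of letters before the
simple root reached is the index of the starting point. -/
theorem exists_spiralWord (h : IsFiniteCartan (cartan V)) {n : ℕ} (π : Fin n ≃ V) {x : V → ℤ}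
    (hx : x ⬝ᵥ (cartan V).mulVec x = 2) (h0 : 0 ≤ x) :
    ∃ (k : Fin n) (m : ℕ), wordRoot π k (spiralWord k m) = x := by
  obtain ⟨L₁, i, L₂, m, hL, he⟩ := h.exists_coxeter_word (L := (List.finRange n).map π)
    ((List.nodup_finRange n).map π.injective)
    (fun i => List.mem_map.2 ⟨π.symm i, by simp, by simp⟩) hx h0
  have hlt : L₁.length < n := by
    have := congrArg List.length hL
    simp at this
    omega
  refine ⟨⟨L₁.length, hlt⟩, m, ?_⟩
  have hi : π ⟨L₁.length, hlt⟩ = i := by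
    have := congrArg (fun l => l[L₁.length]?) hL
    simpa [hlt] using this
  have hL1 : ((List.finRange n).take L₁.length).map π = L₁ := by
    rw [List.map_take, hL]; simp
  rw [wordRoot_eq, hi, he]
  congr 1
  simp [spiralWord, List.map_reverse, hL1, List.map_flatten]

end

/-! ### The Euler form, positive roots and admissible orderings. -/

section

variable {V : Type u} [Fintype V] [Quiver.{v} V]

/-- The Euler form of a quiver. -/
noncomputable def eulerForm (V : Type u) [Fintype V] [Quiver.{v} V] (d e : V → ℤ) : ℤ :=
  ∑ i, d i * e i - ∑ i, ∑ j, (Nat.card (i ⟶ j) : ℤ) * (d i * e j)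

omit [Fintype V] in
theorem IsAcyclic.card_hom_mul (h : IsAcyclic V) (i j : V) :
    Nat.card (i ⟶ j) = 0 ∨ Nat.card (j ⟶ i) = 0 := by
  by_contra! hc
  obtain ⟨⟨a⟩, -⟩ := Nat.card_ne_zero.1 hc.1
  obtain ⟨⟨b⟩, -⟩ := Nat.card_ne_zero.1 hc.2
  have := h i (a.toPath.comp b.toPath)
  simp at this

variable [DecidableEq V]

-- Since arrows between two vertices go in at most one direction, the absolute value of their
-- difference in number is their total number.
omit [Fintype V] in
theorem IsAcyclic.cartan_apply (h : IsAcyclic V) (i j : V) :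
    cartan V i j = 2 * (1 : Matrix V V ℤ) i j - Nat.card (i ⟶ j) - Nat.card (j ⟶ i) := by
  have hij := h.card_hom_mul i j
  by_cases e : i = j
  · subst e
    simp only [or_self] at hij
    simp [cartan, hij]
  · rw [cartan, Matrix.of_apply, if_neg e, Matrix.one_apply_ne e, exchangeMatrix, Matrix.of_apply]
    rcases hij with h | h <;> simp [h]

theorem IsAcyclic.form_eq (h : IsAcyclic V) (x : V → ℤ) :
    x ⬝ᵥ (cartan V).mulVec x = 2 * eulerForm V x x := by
  have e : ∀ i, (cartan V).mulVec x i =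
      2 * x i - ∑ j, (Nat.card (i ⟶ j) : ℤ) * x j - ∑ j, (Nat.card (j ⟶ i) : ℤ) * x j := by
    intro i
    simp only [Matrix.mulVec, dotProduct, h.cartan_apply, sub_mul, Finset.sum_sub_distrib]
    simp [Matrix.one_apply]
  simp only [dotProduct, e, eulerForm, mul_sub, Finset.sum_sub_distrib, Finset.mul_sum]
  rw [Finset.sum_comm (f := fun i j => x i * (((Nat.card (j ⟶ i) : ℤ)) * x j)), sub_sub,
    ← Finset.sum_add_distrib]
  congr 1
  · exact Finset.sum_congr rfl fun i _ => by ring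
  · refine Finset.sum_congr rfl fun i _ => ?_
    rw [← Finset.sum_add_distrib]
    exact Finset.sum_congr rfl fun j _ => by ring

theorem isFiniteCartan (h : IsAcyclic V) (hADE : IsTypeADE V) : IsFiniteCartan (cartan V) where
  symm := by
    ext i j
    rw [Matrix.transpose_apply, h.cartan_apply, h.cartan_apply, Matrix.one_apply, Matrix.one_apply]
    simp only [eq_comm]
    ring
  diag i := by simp [cartan]
  offDiag i j hij := by simp [cartan, hij]
  even x := by rw [h.form_eq]; exact even_two_mul _
  positive := hADE.positive

/-- The common description through which curves and representations are compared with roots. -/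
theorem mem_positiveRoots_iff (h : IsAcyclic V) (hADE : IsTypeADE V) (x : V → ℤ) :
    x ∈ positiveRoots V ↔ 0 ≤ x ∧ eulerForm V x x = 1 := by
  have hC := isFiniteCartan h hADE
  have hf := h.form_eq x
  constructor
  · rintro ⟨hx | hx, h0⟩
    · exact ⟨h0, by have := hC.form_of_isRealRoot hx; omega⟩
    · exact absurd hx hC.not_isImaginaryRoot
  · rintro ⟨h0, hx⟩
    exact ⟨Or.inl (hC.isRealRoot_of_nonneg h0 (by omega)), h0⟩

theorem IsFiniteCartan.wordRoot_form (hC : IsFiniteCartan (cartan V)) {n : ℕ} (π : Fin n ≃ V)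
    (k : Fin n) (w : List (Fin n)) :
    wordRoot π k w ⬝ᵥ (cartan V).mulVec (wordRoot π k w) = 2 := by
  rw [wordRoot_eq, hC.form_reflectAlong, hC.form_simpleRoot]

/-- Associated roots are positive roots. -/
theorem IsAssociatedRoot.mem_positiveRoots (h : IsAcyclic V) (hADE : IsTypeADE V) {n : ℕ}
    {π : Fin n ≃ V} {γ : ℝ → ℝ × ℝ} {α : V → ℤ} (hα : IsAssociatedRoot π γ α) :
    α ∈ positiveRoots V := by
  have hC := isFiniteCartan h hADE
  obtain ⟨k, w, -, -, hw⟩ := hα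
  have hr := hC.wordRoot_form π k w
  rw [mem_positiveRoots_iff h hADE]
  have hf := h.form_eq α
  rcases hw with ⟨h0, rfl⟩ | ⟨h0, rfl⟩
  · exact ⟨h0, by omega⟩
  · refine ⟨?_, ?_⟩
    · have := (hC.nonneg_or_nonpos hr).resolve_left h0
      simpa using this
    · rw [Matrix.mulVec_neg, neg_dotProduct_neg] at hf
      omega

omit [DecidableEq V] in
/-- An acyclic quiver has an admissible ordering. -/
theorem IsAcyclic.exists_admissibleOrdering (h : IsAcyclic V) :
    ∃ π, π ∈ admissibleOrderings V := by
  -- Reachability by paths is antisymmetric because closed paths are trivial. A linear extension of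
  -- it, enumerated in increasing order, is an admissible ordering.
  let P : PartialOrder V :=
    { le := fun i j => Nonempty (Quiver.Path i j)
      le_refl := fun i => ⟨.nil⟩
      le_trans := fun i j l ⟨p⟩ ⟨q⟩ => ⟨p.comp q⟩
      le_antisymm := fun i j ⟨p⟩ ⟨q⟩ => by
        have := h i (p.comp q)
        rw [Quiver.Path.length_comp] at this
        exact Quiver.Path.eq_of_length_zero p (by omega) }
  let : Fintype (LinearExtension V) := ‹Fintype V›
  let e := Fintype.orderIsoFinOfCardEq (LinearExtension V) rfl
  refine ⟨e.toEquiv, fun a b ⟨f⟩ => ?_⟩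
  have hle : (toLinearExtension (α := V)) (e a : V) ≤ toLinearExtension (e b : V) :=
    toLinearExtension.monotone ⟨Quiver.Hom.toPath f⟩
  have : a ≤ b := e.le_iff_le.1 hle
  refine lt_of_le_of_ne this fun hab => ?_
  subst hab
  have := h _ (Quiver.Hom.toPath f)
  simp at this

end

/-! ### Crossing words on intervals -/

/-- The word of the crossings of a curve with the rays at times in `(a, b]`. -/
def IsCrossingWordOn {n : ℕ} (g : ℝ → ℝ × ℝ) (a b : ℝ) (w : List (Fin n)) : Prop :=
  ∃ ts : List ℝ, ts.SortedLT ∧ (∀ t, t ∈ ts ↔ t ∈ Ioc a b ∧ ∃ i : Fin n, g t ∈ ray i) ∧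
    List.Forall₂ (fun t i => g t ∈ ray i) ts w

namespace IsCrossingWordOn

variable {n : ℕ} {g : ℝ → ℝ × ℝ} {a b c : ℝ}

theorem of_forall_notMem (h : ∀ t ∈ Ioc a b, ∀ i : Fin n, g t ∉ ray i) :
    IsCrossingWordOn (n := n) g a b [] :=
  ⟨[], by simp [List.sortedLT_iff_pairwise], fun t => by simpa using fun h1 h2 => h t ⟨h1, h2⟩,
    List.Forall₂.nil⟩

theorem of_last (hab : a < b) (i : Fin n) (hi : g b ∈ ray i)
    (h : ∀ t ∈ Ioo a b, ∀ i : Fin n, g t ∉ ray i) : IsCrossingWordOn g a b [i] := by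
  refine ⟨[b], by simp [List.sortedLT_iff_pairwise], fun t => ?_,
    List.Forall₂.cons hi List.Forall₂.nil⟩
  rw [List.mem_singleton]
  constructor
  · rintro rfl
    exact ⟨⟨hab, le_rfl⟩, i, hi⟩
  · rintro ⟨ht, j, hj⟩
    by_contra hne
    exact h t ⟨ht.1, lt_of_le_of_ne ht.2 hne⟩ j hj

/-- The intervals are open on the left and closed on the right, so a crossing at the common endpoint
is counted exactly once. -/
theorem append {w w' : List (Fin n)} (hab : a ≤ b) (hbc : b ≤ c) (h : IsCrossingWordOn g a b w)
    (h' : IsCrossingWordOn g b c w') : IsCrossingWordOn g a c (w ++ w') := by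
  obtain ⟨ts, hs, hm, hf⟩ := h
  obtain ⟨ts', hs', hm', hf'⟩ := h'
  refine ⟨ts ++ ts', ?_, fun t => ?_, List.rel_append hf hf'⟩
  · rw [List.sortedLT_iff_pairwise] at *
    refine List.pairwise_append.2 ⟨hs, hs', fun x hx y hy => ?_⟩
    exact lt_of_le_of_lt ((hm x).1 hx).1.2 ((hm' y).1 hy).1.1
  · rw [List.mem_append, hm, hm', ← or_and_right, ← mem_union, Ioc_union_Ioc_eq_Ioc hab hbc]

theorem comp_affine {w : List (Fin n)} (hab : a < b) (h : IsCrossingWordOn g a b w) :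
    IsCrossingWord (fun t => g (a + t * (b - a))) w := by
  obtain ⟨ts, hs, hm, hf⟩ := h
  have hd : 0 < b - a := sub_pos.2 hab
  have key : ∀ x, a + (x - a) / (b - a) * (b - a) = x := fun x => by field_simp; ring
  refine ⟨ts.map fun x => (x - a) / (b - a), ?_, fun t => ?_, ?_⟩
  · rw [List.sortedLT_iff_pairwise] at *
    rw [List.pairwise_map]
    refine hs.imp fun {x y} hxy => ?_
    gcongr
  · rw [List.mem_map]
    constructor
    · rintro ⟨x, hx, rfl⟩
      obtain ⟨⟨h1, h2⟩, h3⟩ := (hm x).1 hx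
      refine ⟨⟨div_pos (by linarith) hd, (div_le_one hd).2 (by linarith)⟩, ?_⟩
      simpa only [key] using h3
    · rintro ⟨⟨h1, h2⟩, h3⟩
      refine ⟨a + t * (b - a), (hm _).2 ⟨⟨?_, ?_⟩, h3⟩, ?_⟩
      · nlinarith
      · nlinarith
      · field_simp; ring
  · rw [List.forall₂_map_left_iff]
    simpa only [key] using hf

/-- The word of a curve that moves strictly to the left above the marked points. -/
theorem of_strictAntiOn (j : ℕ) (hj : j ≤ n) (hab : a ≤ b)
    (hc : ContinuousOn (fun t => (g t).1) (Icc a b))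
    (hx : StrictAntiOn (fun t => (g t).1) (Icc a b))
    (hy : ∀ t ∈ Icc a b, 1 ≤ (g t).2) (hb : (g b).1 < 1) (ha : (j : ℝ) < (g a).1)
    (ha' : (g a).1 ≤ j + 1 ∨ j = n) :
    IsCrossingWordOn (n := n) g a b ((List.finRange n).take j).reverse := by
  induction j generalizing a with
  | zero =>
    refine of_forall_notMem fun t ht i hi => ?_
    have h1 : (g t).1 < (g a).1 := hx ⟨le_rfl, hab⟩ ⟨ht.1.le, ht.2⟩ ht.1
    have h2 := hi.1
    have h3 : (0 : ℝ) ≤ (i : ℕ) := Nat.cast_nonneg _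
    rcases ha' with h | h
    · push_cast at h
      linarith
    · exact absurd i.2 (by omega)
  | succ j ih =>
    -- The ray with index j has abscissa j + 1. The curve starts to its right and, by `ha'`, has no
    -- other ray in between, so τ is the first crossing time after a.
    obtain ⟨τ, hτ, hτ'⟩ : (j : ℝ) + 1 ∈ (fun t => (g t).1) '' Icc a b := by
      refine intermediate_value_Icc' hab hc ⟨?_, ?_⟩
      · have : (0 : ℝ) ≤ j := Nat.cast_nonneg _
        linarith
      · push_cast at ha
        exact ha.le
    simp only at hτ'
    have haτ : a < τ := lt_of_le_of_ne hτ.1 (by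
      rintro rfl
      push_cast at ha
      linarith)
    have hsub : Icc τ b ⊆ Icc a b := Icc_subset_Icc_left hτ.1
    have h1 : IsCrossingWordOn (n := n) g a τ [⟨j, hj⟩] := by
      refine of_last haτ _ ⟨hτ', hy τ hτ⟩ fun t ht i hi => ?_
      have h1 : (g t).1 < (g a).1 := hx ⟨le_rfl, hab⟩ ⟨ht.1.le, ht.2.le.trans hτ.2⟩ ht.1
      have h2 : (g τ).1 < (g t).1 := hx ⟨ht.1.le, ht.2.le.trans hτ.2⟩ hτ ht.2
      have h3 := hi.1
      rw [h3, hτ'] at h2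
      have h4 : j < (i : ℕ) := by
        have : (j : ℝ) < (i : ℕ) := by linarith
        exact_mod_cast this
      rcases ha' with h | h
      · push_cast at h
        have : (i : ℕ) < (j : ℝ) + 1 := by linarith
        have : (i : ℕ) < j + 1 := by exact_mod_cast this
        omega
      · have := i.2
        omega
    have h2 := ih (a := τ) (by omega) hτ.2 (hc.mono hsub) (hx.mono hsub)
      (fun t ht => hy t (hsub ht)) (by rw [hτ']; linarith) (Or.inl hτ'.le)
    have := h1.append hτ.1 hτ.2 h2
    rw [List.take_succ_eq_append_getElem (by simpa using hj)]
    simpa using this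

end IsCrossingWordOn

/-! ### Spirals -/

/-- The angle at which the spirals start. -/
noncomputable def startAngle : ℝ := 3 * Real.pi / 4

/-- The radius of the spirals as a function of the angle. -/
noncomputable def spiralRadius (s θ : ℝ) : ℝ :=
  s * ((θ - Real.sin θ) - (startAngle - Real.sin startAngle))

/-- The spiral with centre `(K, 1)`, growth rate `s` and vertical compression `D`. -/
noncomputable def spiral (K s D θ : ℝ) : ℝ × ℝ :=
  (K + spiralRadius s θ * Real.cos θ, 1 + spiralRadius s θ * Real.sin θ / D)

theorem sub_sin_strictMono : StrictMono fun θ : ℝ => θ - Real.sin θ := by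
  intro x y hxy
  have h1 : Real.sin y - Real.sin x < y - x := by
    rw [Real.sin_sub_sin]
    have h2 : |2 * Real.sin ((y - x) / 2) * Real.cos ((y + x) / 2)| ≤
        2 * |Real.sin ((y - x) / 2)| := by
      rw [abs_mul, abs_mul, abs_two]
      exact mul_le_of_le_one_right (by positivity) (Real.abs_cos_le_one _)
    have h3 : |Real.sin ((y - x) / 2)| < (y - x) / 2 := by
      have := Real.abs_sin_lt_abs (x := (y - x) / 2) (by linarith)
      rwa [abs_of_pos (a := (y - x) / 2) (by linarith)] at this
    linarith [le_abs_self (2 * Real.sin ((y - x) / 2) * Real.cos ((y + x) / 2))]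
  simp only
  linarith

theorem startAngle_lt_pi : startAngle < Real.pi := by
  have := Real.pi_pos
  unfold startAngle
  linarith

theorem half_pi_lt_startAngle : Real.pi / 2 < startAngle := by
  have := Real.pi_pos
  unfold startAngle
  linarith

theorem sin_startAngle_pos : 0 < Real.sin startAngle :=
  Real.sin_pos_of_pos_of_lt_pi (by linarith [half_pi_lt_startAngle, Real.pi_pos]) startAngle_lt_pi

theorem cos_startAngle_neg : Real.cos startAngle < 0 :=
  Real.cos_neg_of_pi_div_two_lt_of_lt half_pi_lt_startAngle
    (by linarith [startAngle_lt_pi, Real.pi_pos])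

@[simp] theorem spiralRadius_startAngle (s : ℝ) : spiralRadius s startAngle = 0 := by
  simp [spiralRadius]

section

variable {s : ℝ} (hs : 0 < s)

include hs

theorem spiralRadius_strictMono : StrictMono (spiralRadius s) := by
  intro x y hxy
  have := sub_sin_strictMono hxy
  simp only at this
  unfold spiralRadius
  gcongr

theorem spiralRadius_nonneg {θ : ℝ} (h : startAngle ≤ θ) : 0 ≤ spiralRadius s θ := by
  rw [← spiralRadius_startAngle s]
  exact (spiralRadius_strictMono hs).monotone h

theorem spiralRadius_pos {θ : ℝ} (h : startAngle < θ) : 0 < spiralRadius s θ := by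
  rw [← spiralRadius_startAngle s]
  exact spiralRadius_strictMono hs h

/-- Already at π the radius is s(π/4 + sin(3π/4)). With s ≥ 2(n + 1) it exceeds n + 1 from there on,
which is more than the distance from the centre to any ray. -/
theorem half_lt_spiralRadius {θ : ℝ} (h : Real.pi ≤ θ) : s / 2 < spiralRadius s θ := by
  refine lt_of_lt_of_le ?_ ((spiralRadius_strictMono hs).monotone h)
  unfold spiralRadius
  have h1 := sin_startAngle_pos
  have h2 := Real.pi_gt_three
  have h3 : (1 : ℝ) / 2 < Real.pi - Real.sin Real.pi - (startAngle - Real.sin startAngle) := by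
    rw [Real.sin_pi]
    unfold startAngle at *
    linarith
  nlinarith

theorem le_spiralRadius {θ : ℝ} (h : 2 * Real.pi ≤ θ) : s ≤ spiralRadius s θ := by
  refine le_trans ?_ ((spiralRadius_strictMono hs).monotone h)
  unfold spiralRadius
  have h1 := sin_startAngle_pos
  have h2 := Real.pi_gt_three
  have h3 : (1 : ℝ) ≤ 2 * Real.pi - Real.sin (2 * Real.pi) -
      (startAngle - Real.sin startAngle) := by
    rw [Real.sin_two_pi]
    unfold startAngle at *
    linarith
  nlinarith

end

/-- The spiral starts in the second quadrant, so it reaches the upper right one only after a full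
turn, when its radius is at least s. -/
theorem two_pi_le_of_cos_pos {θ : ℝ} (h0 : startAngle ≤ θ) (hsin : 0 ≤ Real.sin θ)
    (hcos : 0 < Real.cos θ) : 2 * Real.pi ≤ θ := by
  have hpi := Real.pi_pos
  have h1 := half_pi_lt_startAngle
  by_contra! hlt
  rcases le_or_gt θ Real.pi with h | h
  · exact absurd hcos (not_lt.2
      (Real.cos_nonpos_of_pi_div_two_le_of_le (by linarith) (by linarith)))
  · have := Real.sin_neg_of_neg_of_neg_pi_lt (x := θ - 2 * Real.pi) (by linarith) (by linarith)
    rw [Real.sin_sub_two_pi] at this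
    linarith

theorem hasDerivAt_spiralRadius (s θ : ℝ) :
    HasDerivAt (spiralRadius s) (s * (1 - Real.cos θ)) θ :=
  (((hasDerivAt_id θ).sub (Real.hasDerivAt_sin θ)).sub_const _).const_mul s

theorem hasDerivAt_spiral_fst (K s D θ : ℝ) :
    HasDerivAt (fun θ => (spiral K s D θ).1)
      (s * (1 - Real.cos θ) * Real.cos θ + spiralRadius s θ * -Real.sin θ) θ :=
  ((hasDerivAt_spiralRadius s θ).mul (Real.hasDerivAt_cos θ)).const_add K

/-- Where a spiral is above its centre it moves to the left. -/
theorem spiral_deriv_neg {s : ℝ} (hs : 0 < s) {θ : ℝ} (h0 : startAngle ≤ θ)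
    (hsin : 0 < Real.sin θ) :
    s * (1 - Real.cos θ) * Real.cos θ + spiralRadius s θ * -Real.sin θ < 0 := by
  have hA := spiralRadius_nonneg hs h0
  rcases lt_trichotomy (Real.cos θ) 0 with hc | hc | hc
  · have h1 : s * (1 - Real.cos θ) * Real.cos θ < 0 :=
      mul_neg_of_pos_of_neg (mul_pos hs (by linarith)) hc
    nlinarith
  · have h1 : startAngle < θ := lt_of_le_of_ne h0 (by
      rintro rfl
      exact absurd hc cos_startAngle_neg.ne)
    have := mul_pos (spiralRadius_pos hs h1) hsin
    rw [hc]
    linarith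
  -- The radius grows at the rate s(1 - cos θ), which vanishes at multiples of 2π. A constant growth
  -- rate would still push the curve to the right just after them. Here (1 - c)c < 1 - c² = sin² θ ≤
  -- sin θ for c = cos θ.
  · have h1 := le_spiralRadius hs (two_pi_le_of_cos_pos h0 hsin.le hc)
    have h2 : (1 - Real.cos θ) * Real.cos θ < Real.sin θ := by
      nlinarith [Real.sin_sq_add_cos_sq θ, Real.sin_le_one θ, Real.cos_le_one θ]
    nlinarith [mul_lt_mul_of_pos_left h2 hs, mul_le_mul_of_nonneg_right h1 hsin.le]

theorem contDiff_spiral (K s D : ℝ) : ContDiff ℝ ∞ (spiral K s D) := by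
  unfold spiral spiralRadius
  fun_prop

/-- After undoing the compression, the distance to the centre recovers the radius, which is strictly
increasing in the angle. -/
theorem spiral_injOn {K s D : ℝ} (hs : 0 < s) (hD : 0 < D) :
    InjOn (spiral K s D) (Ici startAngle) := by
  intro x hx y hy hxy
  have h1 : spiralRadius s x * Real.cos x = spiralRadius s y * Real.cos y := by
    have := congrArg Prod.fst hxy
    simpa [spiral] using this
  have h2 : spiralRadius s x * Real.sin x = spiralRadius s y * Real.sin y := by
    have := congrArg Prod.snd hxy
    simp only [spiral, add_right_inj] at this
    exact (div_left_inj' hD.ne').1 this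
  have h3 : spiralRadius s x ^ 2 = spiralRadius s y ^ 2 := by
    have e : ∀ a θ : ℝ, a ^ 2 = (a * Real.cos θ) ^ 2 + (a * Real.sin θ) ^ 2 := fun a θ => by
      rw [mul_pow, mul_pow, ← mul_add, Real.cos_sq_add_sin_sq, mul_one]
    rw [e _ x, e (spiralRadius s y) y, h1, h2]
  exact (spiralRadius_strictMono hs).injective
    ((sq_eq_sq₀ (spiralRadius_nonneg hs hx) (spiralRadius_nonneg hs hy)).1 h3)

section

variable {K s D : ℝ} {n : ℕ} (hs : 0 < s) (hK : 1 ≤ K) (hKn : K ≤ n)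
  (hsn : 2 * (n + 1) ≤ s) (hD : 0 < D)

include hs hK hKn hsn hD

-- At multiples of π the spiral meets the horizontal line through its centre, at a distance greater
-- than n + 1.
omit hD in
theorem spiral_fst_of_sin_eq_zero {θ : ℝ} (h0 : startAngle ≤ θ) (hsin : Real.sin θ = 0) :
    (spiral K s D θ).1 < 1 ∨ n < (spiral K s D θ).1 := by
  have hpi : Real.pi ≤ θ := by
    by_contra! hlt
    have := Real.sin_pos_of_pos_of_lt_pi
      (by linarith [half_pi_lt_startAngle, Real.pi_pos] : 0 < θ) hlt
    linarith
  have hA := half_lt_spiralRadius hs hpi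
  have hcos : Real.cos θ = 1 ∨ Real.cos θ = -1 := by
    have := Real.sin_sq_add_cos_sq θ
    rw [hsin] at this
    exact sq_eq_one_iff.1 (by linarith)
  rcases hcos with h | h
  · right
    simp only [spiral, h]
    linarith
  · left
    simp only [spiral, h]
    linarith

/-- Points on a ray have height at least 1, so sin θ ≥ 0; equality would put the point outside the
range of the rays. -/
theorem sin_pos_of_mem_ray {θ : ℝ} (h0 : startAngle ≤ θ) {i : Fin n}
    (hi : spiral K s D θ ∈ ray i) : 0 < Real.sin θ := by
  obtain ⟨h1, h2⟩ := hi
  have hnn : 0 ≤ Real.sin θ := by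
    by_contra! hneg
    have hlt : startAngle < θ := lt_of_le_of_ne h0 (by
      rintro rfl
      linarith [sin_startAngle_pos])
    have := div_neg_of_neg_of_pos (mul_neg_of_pos_of_neg (spiralRadius_pos hs hlt) hneg) hD
    simp only [spiral] at h2
    linarith
  refine lt_of_le_of_ne hnn fun hz => ?_
  have hi' : ((i : ℕ) : ℝ) + 1 ≤ n := by exact_mod_cast i.2
  have hi0 : (0 : ℝ) ≤ (i : ℕ) := Nat.cast_nonneg _
  rcases spiral_fst_of_sin_eq_zero hs hK hKn hsn h0 hz.symm with h | h <;> linarith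

theorem eq_startAngle_of_eq_markedPoint {θ : ℝ} (h0 : startAngle ≤ θ) {i : Fin n}
    (hi : spiral K s D θ = markedPoint i) : θ = startAngle := by
  have hr : spiral K s D θ ∈ ray i := by rw [hi]; exact ⟨rfl, le_rfl⟩
  have hsin := sin_pos_of_mem_ray hs hK hKn hsn hD h0 hr
  have h2 := congrArg Prod.snd hi
  simp only [spiral, markedPoint, add_eq_left, div_eq_zero_iff, mul_eq_zero] at h2
  by_contra hne
  have := spiralRadius_pos hs (lt_of_le_of_ne h0 (Ne.symm hne))
  rcases h2 with (h2 | h2) | h2 <;> linarith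

-- Above its centre the spiral moves strictly to the left by `spiral_deriv_neg`, so each half-turn
-- crosses the rays in decreasing order.
omit hK hKn hsn in
theorem spiral_word_upper {a b : ℝ} (k : ℕ) (hk : k ≤ n) (ha : startAngle ≤ a) (hab : a < b)
    (hj : ∀ θ ∈ Ioo a b, 0 < Real.sin θ) (hb : (spiral K s D b).1 < 1)
    (hka : (k : ℝ) < (spiral K s D a).1)
    (hka' : (spiral K s D a).1 ≤ k + 1 ∨ k = n) :
    IsCrossingWordOn (n := n) (spiral K s D) a b ((List.finRange n).take k).reverse := by
  have hcd := contDiff_spiral K s D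
  have hc : Continuous fun θ => (spiral K s D θ).1 := continuous_fst.comp hcd.continuous
  refine IsCrossingWordOn.of_strictAntiOn k hk hab.le hc.continuousOn ?_ (fun θ hθ => ?_)
    hb hka hka'
  · refine strictAntiOn_of_deriv_neg (convex_Icc a b) hc.continuousOn fun θ hθ => ?_
    rw [interior_Icc] at hθ
    rw [(hasDerivAt_spiral_fst K s D θ).deriv]
    exact spiral_deriv_neg hs (ha.trans hθ.1.le) (hj θ hθ)
  · have hsin : 0 ≤ Real.sin θ := by
      have hcl : IsClosed {θ : ℝ | 0 ≤ Real.sin θ} :=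
        isClosed_le continuous_const Real.continuous_sin
      have : closure (Ioo a b) ⊆ {θ : ℝ | 0 ≤ Real.sin θ} :=
        hcl.closure_subset_iff.2 fun θ hθ => (hj θ hθ).le
      rw [closure_Ioo hab.ne] at this
      exact this hθ
    have := div_nonneg (mul_nonneg (spiralRadius_nonneg hs (ha.trans hθ.1)) hsin) hD.le
    simp only [spiral]
    linarith

/-- Each further turn consists of a lower half, which meets no ray, and an upper half, which passes
over all the marked points from right to left. -/
theorem spiral_word (k : Fin n) (hk : K = k + 1) (m : ℕ) :
    IsCrossingWordOn (spiral K s D) startAngle (m * (2 * Real.pi) + Real.pi) (spiralWord k m) := by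
  have hpi := Real.pi_pos
  have h0 := startAngle_lt_pi
  have hleft : ∀ m : ℕ, (spiral K s D (m * (2 * Real.pi) + Real.pi)).1 < 1 := fun m => by
    have hm : (0 : ℝ) ≤ m * (2 * Real.pi) := by positivity
    have := half_lt_spiralRadius hs (θ := m * (2 * Real.pi) + Real.pi) (by linarith)
    simp only [spiral, Real.cos_nat_mul_two_pi_add_pi]
    linarith
  have hright : ∀ m : ℕ, 0 < m → (n : ℝ) < (spiral K s D (m * (2 * Real.pi))).1 := fun m h => by
    have hm : (1 : ℝ) ≤ m := by exact_mod_cast h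
    have := half_lt_spiralRadius hs (θ := m * (2 * Real.pi)) (by nlinarith)
    simp only [spiral, Real.cos_nat_mul_two_pi]
    linarith
  induction m with
  | zero =>
    have := spiral_word_upper hs hD (n := n) (a := startAngle) (b := Real.pi) k k.2.le
      le_rfl h0 (fun θ hθ => Real.sin_pos_of_pos_of_lt_pi
        (by linarith [hθ.1, half_pi_lt_startAngle]) hθ.2)
      (by simpa using hleft 0) (by simp [spiral, hk]) (by simp [spiral, hk])
    simpa [spiralWord] using this
  | succ m ih =>
    have hm : (0 : ℝ) ≤ m * (2 * Real.pi) := by positivity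
    have hm' : ((m + 1 : ℕ) : ℝ) * (2 * Real.pi) = m * (2 * Real.pi) + 2 * Real.pi := by
      push_cast; ring
    have h1 : IsCrossingWordOn (n := n) (spiral K s D) (m * (2 * Real.pi) + Real.pi)
        ((m + 1 : ℕ) * (2 * Real.pi)) [] := by
      refine .of_forall_notMem fun θ hθ i hi => ?_
      have hsin := sin_pos_of_mem_ray hs hK hKn hsn hD (by linarith [hθ.1]) hi
      rw [hm'] at hθ
      have : Real.sin (θ - (m + 1 : ℕ) * (2 * Real.pi)) ≤ 0 :=
        Real.sin_nonpos_of_nonpos_of_neg_pi_le (by rw [hm']; linarith [hθ.2])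
          (by rw [hm']; linarith [hθ.1])
      rw [Real.sin_sub_nat_mul_two_pi] at this
      linarith
    have h2 := spiral_word_upper hs hD (n := n) (a := (m + 1 : ℕ) * (2 * Real.pi))
      (b := (m + 1 : ℕ) * (2 * Real.pi) + Real.pi) n le_rfl (by rw [hm']; linarith)
      (by linarith) (fun θ hθ => by
        have := Real.sin_pos_of_pos_of_lt_pi (x := θ - (m + 1 : ℕ) * (2 * Real.pi))
          (by linarith [hθ.1]) (by linarith [hθ.2])
        rwa [Real.sin_sub_nat_mul_two_pi] at this)
      (hleft _) (hright _ (Nat.succ_pos m)) (Or.inr rfl)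
    have := (ih.append (by linarith) (by rw [hm']; linarith) h1).append
      (by rw [hm']; linarith) (by linarith) h2
    rw [List.append_nil, List.take_of_length_le (by simp)] at this
    simpa [spiralWord, List.replicate_succ', List.flatten_append] using this

end

/-- A non-self-crossing admissible curve whose word is a given spiral word. -/
theorem exists_spiral_curve {n : ℕ} (k : Fin n) (m : ℕ) :
    ∃ γ ∈ nonSelfCrossingCurves n, γ 0 = markedPoint k ∧ IsCrossingWord γ (spiralWord k m) := by
  set K : ℝ := (k : ℕ) + 1 with hKdef
  have hK : 1 ≤ K := by
    have : (0 : ℝ) ≤ (k : ℕ) := Nat.cast_nonneg _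
    linarith
  have hKn : K ≤ n := by
    rw [hKdef]
    exact_mod_cast k.2
  set s : ℝ := 2 * (n + 1) with hsdef
  have hsn : 2 * ((n : ℝ) + 1) ≤ s := le_rfl
  have hs : 0 < s := by positivity
  have hpi := Real.pi_pos
  have hpi3 := Real.pi_gt_three
  have h0 := startAngle_lt_pi
  set μ : ℝ := m * (2 * Real.pi) with hμdef
  have hμ : 0 ≤ μ := by positivity
  have hsinμ : Real.sin μ = 0 := by simpa using Real.sin_add_nat_mul_two_pi 0 m
  have hcont : Continuous fun θ => (spiral K s 1 θ).1 :=
    continuous_fst.comp (contDiff_spiral K s 1).continuous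
  -- The final angle lies in the lower left quadrant of the last turn, above the abscissa 0 of the
  -- base point being reached. The compression does not affect abscissas, so it is set to 1 here.
  obtain ⟨φ, hφ, hφ0⟩ : (0 : ℝ) ∈ (fun θ => (spiral K s 1 θ).1) ''
      Icc (μ + Real.pi) (μ + Real.pi + Real.pi / 2) := by
    refine intermediate_value_Icc (by linarith) hcont.continuousOn ⟨?_, ?_⟩
    · have := half_lt_spiralRadius hs (θ := μ + Real.pi) (by linarith)
      simp only [spiral, hμdef, Real.cos_nat_mul_two_pi_add_pi]
      simp only [hμdef] at this
      linarith
    · have : Real.cos (μ + Real.pi + Real.pi / 2) = 0 := by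
        rw [Real.cos_add_pi_div_two, Real.sin_add_pi, hsinμ]
        simp
      simp only [spiral, this]
      linarith
  simp only [spiral] at hφ0
  have hφA := half_lt_spiralRadius hs (θ := φ) (by linarith [hφ.1])
  have hstart : startAngle < φ := by linarith [hφ.1]
  have hne : φ ≠ μ + Real.pi := by
    rintro rfl
    rw [hμdef, Real.cos_nat_mul_two_pi_add_pi] at hφ0
    linarith
  have hsinφ : Real.sin φ = - Real.sin (φ - μ - Real.pi) := by
    rw [Real.sin_sub_pi, hμdef, Real.sin_sub_nat_mul_two_pi]
    ring
  have hsinneg : Real.sin φ < 0 := by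
    have := Real.sin_pos_of_pos_of_lt_pi (x := φ - μ - Real.pi)
      (by linarith [lt_of_le_of_ne hφ.1 hne.symm]) (by linarith [hφ.2])
    linarith
  -- The compression is chosen so that the height at φ is 0, hence the endpoint is the base point.
  set D : ℝ := -(spiralRadius s φ * Real.sin φ) with hDdef
  have hD : 0 < D := by
    have := mul_neg_of_pos_of_neg (by linarith : 0 < spiralRadius s φ) hsinneg
    linarith
  have hend : spiral K s D φ = basePoint := by
    have : spiralRadius s φ * Real.sin φ / D = -1 := by
      rw [hDdef, div_neg, div_self (by linarith)]
    simp only [spiral, this, hφ0, basePoint]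
    norm_num
  -- This keeps the curve in the half plane. In the last lower quarter both the radius and -sin θ
  -- increase up to φ. On earlier turns the depth is at most the radius at μ, and D² = r(φ)² - K²
  -- with r(φ) ≥ r(μ) + sπ and K ≤ sπ gives r(μ) ≤ D.
  have hheight : ∀ θ ∈ Icc startAngle φ, -(spiralRadius s θ * Real.sin θ) ≤ D := by
    intro θ hθ
    have hA := spiralRadius_nonneg hs hθ.1
    rcases le_or_gt 0 (Real.sin θ) with hsin | hsin
    · have := mul_nonneg hA hsin
      linarith
    rcases le_or_gt (μ + Real.pi) θ with hlast | hfirst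
    · have h1 : spiralRadius s θ ≤ spiralRadius s φ := (spiralRadius_strictMono hs).monotone hθ.2
      have h2 : -Real.sin θ ≤ -Real.sin φ := by
        have e : ∀ x, -Real.sin x = Real.sin (x - μ - Real.pi) := fun x => by
          rw [Real.sin_sub_pi, hμdef, Real.sin_sub_nat_mul_two_pi]
        rw [e, e]
        exact Real.sin_le_sin_of_le_of_le_pi_div_two (by linarith) (by linarith [hφ.2])
          (by linarith [hθ.2])
      rw [hDdef, ← mul_neg, ← mul_neg]
      exact mul_le_mul h1 h2 (by linarith) (by linarith)
    · have hlt : θ < μ := by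
        by_contra! hge
        have := Real.sin_nonneg_of_nonneg_of_le_pi (x := θ - μ) (by linarith) (by linarith)
        rw [hμdef, Real.sin_sub_nat_mul_two_pi] at this
        linarith
      have h1 : spiralRadius s θ ≤ spiralRadius s μ :=
        (spiralRadius_strictMono hs).monotone hlt.le
      have h2 : spiralRadius s μ + s * Real.pi ≤ spiralRadius s φ := by
        refine le_trans (le_of_eq ?_) ((spiralRadius_strictMono hs).monotone hφ.1)
        simp only [spiralRadius, Real.sin_add_pi, hsinμ]
        ring
      have h3 : -(spiralRadius s θ * Real.sin θ) ≤ spiralRadius s θ := by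
        nlinarith [Real.neg_one_le_sin θ]
      have h4 : K ≤ s * Real.pi := by nlinarith
      have h5 : D ^ 2 = spiralRadius s φ ^ 2 - K ^ 2 := by
        have : spiralRadius s φ * Real.cos φ = -K := by linarith
        have e := Real.sin_sq_add_cos_sq φ
        calc D ^ 2 = spiralRadius s φ ^ 2 * (Real.sin φ ^ 2 + Real.cos φ ^ 2) -
            (spiralRadius s φ * Real.cos φ) ^ 2 := by rw [hDdef]; ring
          _ = _ := by rw [e, this]; ring
      have h6 : spiralRadius s μ ≤ D := by
        refine le_of_sq_le_sq ?_ hD.le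
        rw [h5]
        nlinarith
      linarith
  have hangle : ∀ t ∈ Icc (0 : ℝ) 1, startAngle + t * (φ - startAngle) ∈ Icc startAngle φ :=
    fun t ht => ⟨by nlinarith [ht.1], by nlinarith [ht.2]⟩
  have hinj : ∀ x ∈ Icc (0 : ℝ) 1, ∀ y ∈ Icc (0 : ℝ) 1,
      spiral K s D (startAngle + x * (φ - startAngle)) =
        spiral K s D (startAngle + y * (φ - startAngle)) → x = y := by
    intro x hx y hy hxy
    have := spiral_injOn hs hD (hangle x hx).1 (hangle y hy).1 hxy
    exact mul_right_cancel₀ (sub_pos.2 hstart).ne' (add_left_cancel this)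
  have hbegin : spiral K s D startAngle = markedPoint k := by
    simp [spiral, markedPoint, hKdef]
  refine ⟨fun t => spiral K s D (startAngle + t * (φ - startAngle)), ⟨⟨?_, ?_, ?_, ?_, ?_, ?_⟩, ?_⟩,
    ?_, ?_⟩
  · exact ((contDiff_spiral K s D).comp (by fun_prop)).contDiffOn
  · intro t ht
    have := hheight _ (hangle t ht)
    have h1 := (div_le_one hD).2 this
    rw [neg_div] at h1
    simp only [halfPlane, mem_ofPred_eq, spiral]
    linarith
  · exact ⟨k, by simpa using hbegin⟩
  · simpa using hend
  · rintro t ht (h | ⟨i, h⟩)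
    · right
      refine hinj t ht 1 ⟨zero_le_one, le_rfl⟩ ?_
      rw [h, ← hend]
      congr 1
      ring
    · left
      have := eq_startAngle_of_eq_markedPoint hs hK hKn hsn hD (hangle t ht).1 h
      have h2 : t * (φ - startAngle) = 0 := by linarith
      exact (mul_eq_zero.1 h2).resolve_right (sub_pos.2 hstart).ne'
  · intro i _ t ht hray
    have hsin := sin_pos_of_mem_ray hs hK hKn hsn hD (hangle t ht).1 hray
    have hneg := spiral_deriv_neg hs (hangle t ht).1 hsin
    have hlin : HasDerivAt (fun t : ℝ => startAngle + t * (φ - startAngle)) (φ - startAngle) t := by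
      simpa using ((hasDerivAt_id t).mul_const (φ - startAngle)).const_add startAngle
    have hdiff : DifferentiableAt ℝ
        (fun t : ℝ => spiral K s D (startAngle + t * (φ - startAngle))) t :=
      (((contDiff_spiral K s D).differentiable (by simp)) _).comp t hlin.differentiableAt
    rw [hdiff.derivWithin (uniqueDiffOn_Icc zero_lt_one t ht)]
    have h1 := (ContinuousLinearMap.fst ℝ ℝ ℝ).hasFDerivAt.comp_hasDerivAt t hdiff.hasDerivAt
    have h2 := (hasDerivAt_spiral_fst K s D (startAngle + t * (φ - startAngle))).comp t hlin
    have h3 := h1.unique h2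
    rw [ContinuousLinearMap.coe_fst'] at h3
    rw [h3]
    exact (mul_neg_of_neg_of_pos hneg (sub_pos.2 hstart)).ne
  · intro x hx y hy hxy
    exact hinj x hx y hy hxy
  · simpa using hbegin
  · have h1 := spiral_word hs hK hKn hsn hD k hKdef m
    have h2 : IsCrossingWordOn (n := n) (spiral K s D) (μ + Real.pi) φ [] := by
      refine .of_forall_notMem fun θ hθ i hi => ?_
      have hsin := sin_pos_of_mem_ray hs hK hKn hsn hD (by linarith [hθ.1]) hi
      have := Real.sin_nonneg_of_nonneg_of_le_pi (x := θ - μ - Real.pi)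
        (by linarith [hθ.1]) (by linarith [hθ.2, hφ.2])
      rw [Real.sin_sub_pi, hμdef, Real.sin_sub_nat_mul_two_pi] at this
      linarith
    have h3 := h1.append (by linarith) hφ.1 h2
    rw [List.append_nil] at h3
    exact h3.comp_affine hstart

/-! ### Representations as families of linear maps -/

section

variable {k : Type*} [Field k]

/-- The map factors through the range of `t` and extends from there to all of F. -/
theorem exists_factor {E F G : Type*} [AddCommGroup E] [Module k E] [AddCommGroup F] [Module k F]
    [AddCommGroup G] [Module k G] (t : E →ₗ[k] F) (φ : E →ₗ[k] G)
    (h : ∀ x, t x = 0 → φ x = 0) : ∃ φ' : F →ₗ[k] G, ∀ x, φ' (t x) = φ x := by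
  obtain ⟨g, hg⟩ := t.rangeRestrict.exists_rightInverse_of_surjective t.range_rangeRestrict
  obtain ⟨φ', hφ'⟩ := LinearMap.exists_extend (φ ∘ₗ g)
  refine ⟨φ', fun x => ?_⟩
  have h1 : φ' (t x) = φ (g (t.rangeRestrict x)) := by
    have := LinearMap.congr_fun hφ' (t.rangeRestrict x)
    simpa using this
  have h2 : t (g (t.rangeRestrict x) - x) = 0 := by
    have := congrArg Subtype.val (LinearMap.congr_fun hg (t.rangeRestrict x))
    rw [map_sub, sub_eq_zero]
    simpa using this
  rw [h1, ← sub_eq_zero, ← map_sub, h _ h2]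

variable {V : Type u} [Quiver.{v} V]

/-- A family of linear maps along the arrows of a quiver. -/
abbrev ArrowMaps (k : Type*) [Field k] {V : Type u} [Quiver.{v} V] (X Y : V → Type*)
    [∀ i, AddCommGroup (X i)] [∀ i, Module k (X i)]
    [∀ i, AddCommGroup (Y i)] [∀ i, Module k (Y i)] : Type _ :=
  ∀ i j : V, (i ⟶ j) → (X i →ₗ[k] Y j)

variable {X Y : V → Type*} [∀ i, AddCommGroup (X i)] [∀ i, Module k (X i)]
  [∀ i, AddCommGroup (Y i)] [∀ i, Module k (Y i)]

/-- The map whose kernel is `Hom` and whose cokernel is `Ext¹` between representations. -/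
def commutatorMap (f : ArrowMaps k X X) (g : ArrowMaps k Y Y) :
    (∀ i, X i →ₗ[k] Y i) →ₗ[k] ArrowMaps k X Y where
  toFun ψ := fun i j a => g i j a ∘ₗ ψ i - ψ j ∘ₗ f i j a
  map_add' ψ ψ' := by
    funext i j a
    ext x
    simp only [Pi.add_apply, LinearMap.sub_apply, LinearMap.comp_apply, LinearMap.add_apply,
      map_add]
    abel
  map_smul' c ψ := by
    funext i j a
    ext x
    simp [smul_sub]

theorem commutatorMap_apply (f : ArrowMaps k X X) (g : ArrowMaps k Y Y) (ψ : ∀ i, X i →ₗ[k] Y i)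
    {i j : V} (a : i ⟶ j) (x : X i) :
    commutatorMap f g ψ i j a x = g i j a (ψ i x) - ψ j (f i j a x) := rfl

/-- Morphisms of representations. -/
abbrev repHom (f : ArrowMaps k X X) (g : ArrowMaps k Y Y) : Submodule k (∀ i, X i →ₗ[k] Y i) :=
  LinearMap.ker (commutatorMap f g)

theorem mem_repHom {f : ArrowMaps k X X} {g : ArrowMaps k Y Y} {ψ : ∀ i, X i →ₗ[k] Y i} :
    ψ ∈ repHom f g ↔ ∀ (i j : V) (a : i ⟶ j) (x : X i), g i j a (ψ i x) = ψ j (f i j a x) := by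
  rw [LinearMap.mem_ker]
  constructor
  · intro h i j a x
    have := LinearMap.congr_fun (congrFun (congrFun (congrFun h i) j) a) x
    exact sub_eq_zero.1 this
  · intro h
    funext i j a
    ext x
    rw [commutatorMap_apply, h, sub_self]
    rfl

/-- A nonzero representation without nontrivial idempotent endomorphisms. -/
def IsIndecomposableRep (f : ArrowMaps k X X) : Prop :=
  (∃ i, Nontrivial (X i)) ∧ ∀ e ∈ repHom f f, (∀ i x, e i (e i x) = e i x) →
    e = 0 ∨ e = fun _ => LinearMap.id

/-- The restriction of a representation to a family of stable subspaces. -/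
def restrictRep (f : ArrowMaps k X X) (U : ∀ i, Submodule k (X i))
    (hU : ∀ (i j : V) (a : i ⟶ j), ∀ x ∈ U i, f i j a x ∈ U j) :
    ArrowMaps k (fun i => U i) (fun i => U i) :=
  fun i j a => (f i j a).restrict (hU i j a)

theorem projection_mem_repHom {f : ArrowMaps k X X} {U W : ∀ i, Submodule k (X i)}
    (hU : ∀ (i j : V) (a : i ⟶ j), ∀ x ∈ U i, f i j a x ∈ U j)
    (hW : ∀ (i j : V) (a : i ⟶ j), ∀ x ∈ W i, f i j a x ∈ W j)
    (hc : ∀ i, IsCompl (U i) (W i)) : (fun i => (U i).projection (W i) (hc i)) ∈ repHom f f := by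
  rw [mem_repHom]
  intro i j a x
  obtain ⟨y, hy, z, hz, rfl⟩ := Submodule.mem_sup.1 (((hc i).sup_eq_top ▸ Submodule.mem_top :
    x ∈ U i ⊔ W i))
  rw [map_add, map_add, map_add, map_add, Submodule.projection_apply_of_mem_left _ hy,
    (Submodule.projection_apply_eq_zero_iff (hc i)).2 hz,
    Submodule.projection_apply_of_mem_left _ (hU i j a y hy),
    (Submodule.projection_apply_eq_zero_iff (hc j)).2 (hW i j a z hz)]
  simp

/-- An indecomposable representation has no nontrivial decomposition into stable subspaces. -/
theorem IsIndecomposableRep.eq_bot_or_eq_bot {f : ArrowMaps k X X} (h : IsIndecomposableRep f)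
    {U W : ∀ i, Submodule k (X i)}
    (hU : ∀ (i j : V) (a : i ⟶ j), ∀ x ∈ U i, f i j a x ∈ U j)
    (hW : ∀ (i j : V) (a : i ⟶ j), ∀ x ∈ W i, f i j a x ∈ W j)
    (hc : ∀ i, IsCompl (U i) (W i)) : (∀ i, U i = ⊥) ∨ (∀ i, W i = ⊥) := by
  rcases h.2 _ (projection_mem_repHom hU hW hc)
    (fun i x => Submodule.projection_apply_of_mem_left _ (Submodule.projection_apply_mem _ _))
    with h | h
  · left
    intro i
    rw [← Submodule.range_projection (hc i), congrFun h i]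
    simp
  · right
    intro i
    rw [← Submodule.ker_projection (hc i), congrFun h i]
    simp

section Dimension

variable [Fintype V] [∀ i j : V, Finite (i ⟶ j)] [∀ i, Module.Finite k (X i)]
  [∀ i, Module.Finite k (Y i)]

/-- The dimension vector of a family of vector spaces. -/
noncomputable def dimVector (k : Type*) [Field k] {V : Type u} (X : V → Type*)
    [∀ i, AddCommGroup (X i)] [∀ i, Module k (X i)] : V → ℤ :=
  fun i => Module.finrank k (X i)

/-- Rank-nullity for `commutatorMap`; moving terms across reads dim Hom - dim Ext¹ = Euler form. -/
theorem finrank_sub_eulerForm (f : ArrowMaps k X X) (g : ArrowMaps k Y Y) :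
    (Module.finrank k (repHom f g) : ℤ) +
      Module.finrank k (LinearMap.range (commutatorMap f g)) =
    eulerForm V (dimVector k X) (dimVector k Y) + Module.finrank k (ArrowMaps k X Y) := by
  classical
  have : ∀ i j : V, Fintype (i ⟶ j) := fun i j => Fintype.ofFinite _
  have h := (commutatorMap f g).finrank_range_add_finrank_ker
  have h1 : Module.finrank k (ArrowMaps k X Y) =
      ∑ i, ∑ j, Nat.card (i ⟶ j) * (Module.finrank k (X i) * Module.finrank k (Y j)) := by
    rw [Module.finrank_pi_fintype]
    refine Finset.sum_congr rfl fun i _ => ?_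
    rw [Module.finrank_pi_fintype]
    refine Finset.sum_congr rfl fun j _ => ?_
    rw [Module.finrank_pi_fintype]
    simp [Module.finrank_linearMap]
  have h2 : Module.finrank k (∀ i, X i →ₗ[k] Y i) =
      ∑ i, Module.finrank k (X i) * Module.finrank k (Y i) := by
    rw [Module.finrank_pi_fintype]
    simp [Module.finrank_linearMap]
  rw [h2] at h
  rw [h1, add_comm]
  have h3 := congrArg (Nat.cast : ℕ → ℤ) h
  push_cast at h3 ⊢
  rw [h3]
  simp [eulerForm, dimVector]

theorem eulerForm_le_finrank (f : ArrowMaps k X X) (g : ArrowMaps k Y Y) :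
    eulerForm V (dimVector k X) (dimVector k Y) ≤ Module.finrank k (repHom f g) := by
  have h := finrank_sub_eulerForm f g
  have h1 := Submodule.finrank_le (LinearMap.range (commutatorMap f g))
  omega

theorem surjective_commutatorMap_iff (f : ArrowMaps k X X) (g : ArrowMaps k Y Y) :
    Function.Surjective (commutatorMap f g) ↔
      (Module.finrank k (repHom f g) : ℤ) = eulerForm V (dimVector k X) (dimVector k Y) := by
  have h := finrank_sub_eulerForm f g
  rw [← LinearMap.range_eq_top]
  constructor
  · intro ht
    rw [ht, finrank_top] at h
    omega
  · intro he
    exact Submodule.eq_top_of_finrank_eq (by omega)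

end Dimension

end

/-! ### Endomorphisms of indecomposable representations. -/

section

variable {k : Type*} [Field k] {V : Type u} [Quiver.{v} V] [Fintype V]
  {X : V → Type*} [∀ i, AddCommGroup (X i)] [∀ i, Module k (X i)] [∀ i, Module.Finite k (X i)]

omit [Fintype V] in
/-- An endomorphism of an indecomposable representation that is neither zero nor injective and has
minimal rank among all such has square zero. -/
theorem IsIndecomposableRep.comp_self_eq_zero {f : ArrowMaps k X X} (hf : IsIndecomposableRep f)
    {h : ∀ i, X i →ₗ[k] X i} (hh : h ∈ repHom f f) (h0 : h ≠ 0)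
    {i₀ : V} (hi₀ : ¬ Function.Injective (h i₀))
    (hrank : (fun i => h i ∘ₗ h i) ≠ 0 → ∀ i, Module.finrank k (LinearMap.range (h i)) ≤
      Module.finrank k (LinearMap.range (h i ∘ₗ h i))) :
    ∀ i x, h i (h i x) = 0 := by
  by_contra hne
  rw [mem_repHom] at hh
  have hne' : (fun i => h i ∘ₗ h i) ≠ 0 := by
    intro hz
    refine hne fun i x => ?_
    have := LinearMap.congr_fun (congrFun hz i) x
    simpa using this
  -- If h² ≠ 0, minimality gives h² the same rank as h at each vertex. Then X is the direct sum of
  -- the image and the kernel of h, as in Fitting's lemma, against indecomposability.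
  have hr : ∀ i, LinearMap.range (h i ∘ₗ h i) = LinearMap.range (h i) := fun i =>
    Submodule.eq_of_le_of_finrank_le (LinearMap.range_comp_le_range _ _) (hrank hne' i)
  have hd : ∀ i, Disjoint (LinearMap.range (h i)) (LinearMap.ker (h i)) := by
    intro i
    have hk : LinearMap.ker (h i) = LinearMap.ker (h i ∘ₗ h i) := by
      refine Submodule.eq_of_le_of_finrank_eq (LinearMap.ker_le_ker_comp _ _) ?_
      have h1 := (h i).finrank_range_add_finrank_ker
      have h2 := (h i ∘ₗ h i).finrank_range_add_finrank_ker
      rw [hr i] at h2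
      omega
    rw [Submodule.disjoint_def]
    rintro _ ⟨y, rfl⟩ hy
    have : y ∈ LinearMap.ker (h i ∘ₗ h i) := hy
    rwa [← hk] at this
  have hc : ∀ i, IsCompl (LinearMap.range (h i)) (LinearMap.ker (h i)) := fun i =>
    (Submodule.isCompl_iff_disjoint _ _
      ((h i).finrank_range_add_finrank_ker.ge)).2 (hd i)
  rcases hf.eq_bot_or_eq_bot (U := fun i => LinearMap.range (h i))
    (W := fun i => LinearMap.ker (h i)) (fun i j a x hx => by
      obtain ⟨y, rfl⟩ := hx
      exact ⟨f i j a y, (hh i j a y).symm⟩) (fun i j a x hx => by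
      rw [LinearMap.mem_ker] at hx ⊢
      rw [← hh, hx, map_zero]) hc with hb | hb
  · exact h0 (funext fun i => LinearMap.range_eq_bot.1 (hb i))
  · exact hi₀ (LinearMap.ker_eq_bot.1 (hb i₀))

omit [∀ i, Module.Finite k (X i)] in
/-- A minimal direct summand of a stable subspace `K` that is not killed when `I` is projected onto
it along its complement is indecomposable. -/
theorem exists_indecomposable_summand [∀ i, Module.Finite k (X i)] {f : ArrowMaps k X X}
    {I K : ∀ i, Submodule k (X i)}
    (hK : ∀ (i j : V) (a : i ⟶ j), ∀ x ∈ K i, f i j a x ∈ K j) (hIK : ∀ i, I i ≤ K i)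
    (hI : ∃ i, I i ≠ ⊥) :
    ∃ (U W : ∀ i, Submodule k (X i)) (hU : ∀ (i j : V) (a : i ⟶ j), ∀ x ∈ U i, f i j a x ∈ U j),
      (∀ (i j : V) (a : i ⟶ j), ∀ x ∈ W i, f i j a x ∈ W j) ∧ (∀ i, Disjoint (U i) (W i)) ∧
      (∀ i, U i ⊔ W i = K i) ∧ (∃ i, ¬ I i ≤ W i) ∧ IsIndecomposableRep (restrictRep f U hU) := by
  classical
  let P : ℕ → Prop := fun N => ∃ U W : ∀ i, Submodule k (X i),
    (∀ (i j : V) (a : i ⟶ j), ∀ x ∈ U i, f i j a x ∈ U j) ∧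
    (∀ (i j : V) (a : i ⟶ j), ∀ x ∈ W i, f i j a x ∈ W j) ∧ (∀ i, Disjoint (U i) (W i)) ∧
    (∀ i, U i ⊔ W i = K i) ∧ (∃ i, ¬ I i ≤ W i) ∧ ∑ i, Module.finrank k (U i) = N
  have hP : ∃ N, P N := by
    obtain ⟨i, hi⟩ := hI
    exact ⟨_, K, fun _ => ⊥, hK, fun i j a x hx => by simp_all, fun i => disjoint_bot_right,
      fun i => sup_bot_eq _, ⟨i, fun h => hi (le_bot_iff.1 h)⟩, rfl⟩
  obtain ⟨U, W, hU, hW, hd, hs, ⟨i₁, hi₁⟩, hN⟩ := Nat.find_spec hP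
  refine ⟨U, W, hU, hW, hd, hs, ⟨i₁, hi₁⟩, ⟨i₁, ?_⟩, ?_⟩
  · by_contra hc
    rw [not_nontrivial_iff_subsingleton, Submodule.subsingleton_iff_eq_bot] at hc
    refine hi₁ ?_
    have := hs i₁
    rw [hc, bot_sup_eq] at this
    exact this ▸ hIK i₁
  intro e he hee
  rw [mem_repHom] at he
  have he' : ∀ (i j : V) (a : i ⟶ j) (x : U i),
      f i j a (e i x : X i) = (e j ⟨f i j a x, hU i j a x x.2⟩ : X j) := fun i j a x =>
    congrArg Subtype.val (he i j a x)
  -- the two summands of `U`, and the key step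
  have key : ∀ e₁ e₂ : ∀ i, U i →ₗ[k] U i, (∀ i x, e₁ i x + e₂ i x = x) →
      (∀ i x, e₁ i (e₂ i x) = 0) → (∀ i x, e₁ i (e₁ i x) = e₁ i x) →
      (∀ i x, e₂ i (e₂ i x) = e₂ i x) →
      (∀ (i j : V) (a : i ⟶ j) (x : U i),
        f i j a (e₁ i x : X i) = (e₁ j ⟨f i j a x, hU i j a x x.2⟩ : X j)) →
      (∀ (i j : V) (a : i ⟶ j) (x : U i),
        f i j a (e₂ i x : X i) = (e₂ j ⟨f i j a x, hU i j a x x.2⟩ : X j)) → e₂ ≠ 0 →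
      ∀ i, I i ≤ W i ⊔ (LinearMap.range (e₂ i)).map (U i).subtype := by
    intro e₁ e₂ hsum h12 h11 h22 hc1 hc2 hne
    by_contra hcon
    rw [not_forall] at hcon
    -- Otherwise the image of e₁, with complement W plus the image of e₂, would be a smaller summand
    -- onto which I still projects nontrivially.
    have hlt : ∑ i, Module.finrank k ((LinearMap.range (e₁ i)).map (U i).subtype) <
        ∑ i, Module.finrank k (U i) := by
      have hle : ∀ i, (LinearMap.range (e₁ i)).map (U i).subtype ≤ U i := fun i =>
        Submodule.map_subtype_le _ _
      refine Finset.sum_lt_sum (fun i _ => Submodule.finrank_mono (hle i)) ?_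
      by_contra! hall
      refine hne (funext fun i => LinearMap.ext fun x => ?_)
      have htop := Submodule.eq_of_le_of_finrank_le (hle i) (hall i (Finset.mem_univ i))
      obtain ⟨y, ⟨z, rfl⟩, hz⟩ : (e₂ i x : X i) ∈ (LinearMap.range (e₁ i)).map (U i).subtype := by
        rw [htop]; exact (e₂ i x).2
      have hz' : e₁ i z = e₂ i x := Subtype.ext hz
      have h1 := h12 i x
      rw [← hz', h11] at h1
      rw [← hz', h1]
      rfl
    have hmin := Nat.find_min' hP (m := ∑ i, Module.finrank k
      ((LinearMap.range (e₁ i)).map (U i).subtype))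
      ⟨fun i => (LinearMap.range (e₁ i)).map (U i).subtype,
        fun i => W i ⊔ (LinearMap.range (e₂ i)).map (U i).subtype, ?_, ?_, ?_, ?_, hcon, rfl⟩
    · rw [hN] at hlt
      omega
    · rintro i j a _ ⟨_, ⟨x, rfl⟩, rfl⟩
      exact ⟨_, ⟨_, rfl⟩, (hc1 i j a x).symm⟩
    · intro i j a x hx
      obtain ⟨y, hy, _, ⟨_, ⟨z, rfl⟩, rfl⟩, rfl⟩ := Submodule.mem_sup.1 hx
      rw [map_add]
      refine Submodule.add_mem_sup (hW i j a y hy) ⟨_, ⟨_, rfl⟩, (hc2 i j a z).symm⟩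
    · intro i
      rw [Submodule.disjoint_def]
      rintro _ ⟨_, ⟨x, rfl⟩, rfl⟩ hx
      obtain ⟨y, hy, _, ⟨_, ⟨z, rfl⟩, rfl⟩, hyz⟩ := Submodule.mem_sup.1 hx
      have hy0 : y = 0 := by
        refine Submodule.disjoint_def.1 (hd i) y ?_ hy
        rw [eq_sub_of_add_eq hyz]
        exact Submodule.sub_mem _ (e₁ i x).2 (e₂ i z).2
      rw [hy0, zero_add] at hyz
      have hyz' : e₂ i z = e₁ i x := Subtype.ext hyz
      have h1 := h12 i z
      rw [hyz', h11] at h1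
      rw [h1]
      rfl
    · intro i
      refine le_antisymm (sup_le ((Submodule.map_subtype_le _ _).trans (hs i ▸ le_sup_left))
        (sup_le (hs i ▸ le_sup_right)
          ((Submodule.map_subtype_le _ _).trans (hs i ▸ le_sup_left)))) ?_
      rw [← hs i]
      refine sup_le (fun x hx => ?_) (le_sup_left.trans le_sup_right)
      have hx' := congrArg Subtype.val (hsum i ⟨x, hx⟩)
      rw [Submodule.coe_add] at hx'
      have : x = (e₁ i ⟨x, hx⟩ : X i) + (e₂ i ⟨x, hx⟩ : X i) := hx'.symm
      rw [this]
      exact Submodule.add_mem_sup ⟨_, ⟨_, rfl⟩, rfl⟩ (Submodule.mem_sup_right ⟨_, ⟨_, rfl⟩, rfl⟩)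
  by_contra! hcon
  -- For a nontrivial idempotent e, I lies both in W + im(1 - e) and in W + im e. Their intersection
  -- is W, contrary to the choice of W.
  have hk1 := key e (fun i => LinearMap.id - e i) (fun i x => by simp) (fun i x => by simp [hee])
    hee (fun i x => by simp [hee]) he' (fun i j a x => by simp [he']) (fun hz => hcon.2 (by
      funext i
      exact (sub_eq_zero.1 (congrFun hz i)).symm))
  have hk2 := key (fun i => LinearMap.id - e i) e (fun i x => by simp) (fun i x => by simp [hee])
    (fun i x => by simp [hee]) hee (fun i j a x => by simp [he']) he' hcon.1
  refine hi₁ fun x hx => ?_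
  obtain ⟨y, hy, _, ⟨_, ⟨z, rfl⟩, rfl⟩, hyz⟩ := Submodule.mem_sup.1 (hk1 i₁ hx)
  obtain ⟨y', hy', _, ⟨_, ⟨z', rfl⟩, rfl⟩, hyz'⟩ := Submodule.mem_sup.1 (hk2 i₁ hx)
  simp only [LinearMap.sub_apply, LinearMap.id_apply, Submodule.subtype_apply] at hyz hyz'
  have hsub : y - y' = 0 := by
    refine Submodule.disjoint_def.1 (hd i₁) _ ?_ (Submodule.sub_mem _ hy hy')
    have : y - y' = ((e i₁ z' - (z - e i₁ z) : U i₁) : X i₁) := by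
      rw [Submodule.coe_sub, eq_sub_of_add_eq hyz, eq_sub_of_add_eq hyz']
      abel
    rw [this]
    exact Subtype.property _
  have hyy : y = y' := sub_eq_zero.1 hsub
  rw [← hyy, ← hyz] at hyz'
  have h3 : e i₁ z' = z - e i₁ z := Subtype.ext (add_left_cancel hyz')
  have h4 : z - e i₁ z = 0 := by
    have := congrArg (e i₁) h3
    rw [hee, map_sub, hee, sub_self] at this
    rw [← h3, this]
  rw [h4] at hyz
  rw [← hyz]
  simpa using hy

end

section

variable {k : Type*} [Field k] {V : Type u} [Quiver.{v} V]

section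

variable {X : V → Type*} [∀ i, AddCommGroup (X i)] [∀ i, Module k (X i)]

theorem id_mem_repHom (f : ArrowMaps k X X) :
    (fun _ => LinearMap.id : ∀ i, X i →ₗ[k] X i) ∈ repHom f f := by
  rw [mem_repHom]
  exact fun _ _ _ _ => rfl

omit [Quiver.{v} V] in
theorem id_ne_zero (h : ∃ i, Nontrivial (X i)) :
    (fun _ => LinearMap.id : ∀ i, X i →ₗ[k] X i) ≠ 0 := by
  obtain ⟨i, hi⟩ := h
  obtain ⟨x, hx⟩ := exists_ne (0 : X i)
  intro hz
  exact hx (LinearMap.congr_fun (congrFun hz i) x)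

omit [Quiver.{v} V] in
theorem dimVector_ne_zero [∀ i, Module.Finite k (X i)] (h : ∃ i, Nontrivial (X i)) :
    dimVector k X ≠ 0 := by
  obtain ⟨i, hi⟩ := h
  intro hz
  have := congrFun hz i
  simp only [dimVector, Pi.zero_apply, Nat.cast_eq_zero] at this
  exact Module.finrank_pos.ne' this

/-- If all endomorphisms of a nonzero representation are scalars and the Euler form is positive,
then there are no self-extensions. -/
theorem surjective_of_scalar [Fintype V] [∀ i j : V, Finite (i ⟶ j)] [∀ i, Module.Finite k (X i)]
    (hpos : ∀ d : V → ℤ, d ≠ 0 → 0 < eulerForm V d d) (f : ArrowMaps k X X)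
    (h : ∃ i, Nontrivial (X i))
    (hs : ∀ e ∈ repHom f f, ∃ c : k, ∀ i x, e i x = c • x) :
    Function.Surjective (commutatorMap f f) ∧
      eulerForm V (dimVector k X) (dimVector k X) = 1 := by
  have h1 : Module.finrank k (repHom f f) = 1 := by
    refine finrank_eq_one_iff'.2 ⟨⟨_, id_mem_repHom f⟩, ?_, ?_⟩
    · intro hz
      exact id_ne_zero h (congrArg Subtype.val hz)
    · rintro ⟨e, he⟩
      obtain ⟨c, hc⟩ := hs e he
      exact ⟨c, Subtype.ext (funext fun i => LinearMap.ext fun x => (hc i x).symm)⟩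
  have h2 := eulerForm_le_finrank f f
  have h3 := hpos _ (dimVector_ne_zero (k := k) h)
  -- The inequalities 0 < q ≤ dim End = 1 leave only q = 1, which is the numerical criterion for
  -- surjectivity.
  rw [surjective_commutatorMap_iff, h1]
  rw [h1] at h2
  push_cast at *
  omega

/-- A nonscalar endomorphism yields a nonzero endomorphism that is not injective. -/
theorem exists_noninjective_endomorphism [IsAlgClosed k] [∀ i, Module.Finite k (X i)]
    {f : ArrowMaps k X X} (h : ∃ i, Nontrivial (X i)) {g : ∀ i, X i →ₗ[k] X i}
    (hg : g ∈ repHom f f) (hns : ∀ c : k, ∃ i x, g i x ≠ c • x) :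
    ∃ g' ∈ repHom f f, g' ≠ 0 ∧ ∃ i, ¬ Function.Injective (g' i) := by
  obtain ⟨i, hi⟩ := h
  obtain ⟨c, hc⟩ := Module.End.exists_eigenvalue (K := k) (V := X i) (g i)
  refine ⟨fun i => g i - c • LinearMap.id, ?_, fun hz => ?_, i, ?_⟩
  · rw [mem_repHom] at hg ⊢
    intro i j a x
    simp [hg]
  · obtain ⟨j, x, hx⟩ := hns c
    exact hx (sub_eq_zero.1 (LinearMap.congr_fun (congrFun hz j) x))
  obtain ⟨x, hx⟩ := hc.exists_hasEigenvector
  intro hinj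
  refine hx.2 (hinj ?_)
  have : g i x = c • x := hx.apply_eq_smul
  simp [this]

end

variable [Fintype V] [∀ i j : V, Finite (i ⟶ j)]

-- A nonscalar endomorphism would give a nonzero noninjective h of minimal rank, with h² = 0. Let U
-- be an indecomposable summand of ker h onto which im h projects nontrivially. A linear retraction
-- r of X onto U, extending the projection of ker h, fails to be a morphism by a term that factors
-- through r ∘ h. As U has no self-extensions, r can be corrected without changing it on U, so U
-- splits off X. Then U = 0 or U = X, and both are impossible.
omit [∀ i j : V, Finite (i ⟶ j)] in
theorem scalar_of_surjective_summands [IsAlgClosed k] {X : V → Type w} [∀ i, AddCommGroup (X i)]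
    [∀ i, Module k (X i)] [∀ i, Module.Finite k (X i)] (f : ArrowMaps k X X)
    (hf : IsIndecomposableRep f)
    (ih : ∀ (U : ∀ i, Submodule k (X i))
      (hU : ∀ (i j : V) (a : i ⟶ j), ∀ x ∈ U i, f i j a x ∈ U j),
      IsIndecomposableRep (restrictRep f U hU) → (∃ i, U i ≠ ⊤) →
      Function.Surjective (commutatorMap (restrictRep f U hU) (restrictRep f U hU))) :
    ∀ e ∈ repHom f f, ∃ c : k, ∀ i x, e i x = c • x := by
  classical
  by_contra! hcon
  obtain ⟨g, hg, hns⟩ := hcon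
  -- a nonzero noninjective endomorphism of minimal rank
  let P : ℕ → Prop := fun N => ∃ g ∈ repHom f f, g ≠ 0 ∧ (∃ i, ¬ Function.Injective (g i)) ∧
    ∑ i, Module.finrank k (LinearMap.range (g i)) = N
  have hP : ∃ N, P N := by
    obtain ⟨g', h1, h2, h3⟩ := exists_noninjective_endomorphism hf.1 hg hns
    exact ⟨_, g', h1, h2, h3, rfl⟩
  obtain ⟨h, hh, h0, ⟨i₀, hi₀⟩, hN⟩ := Nat.find_spec hP
  have hmin : ∀ g ∈ repHom f f, g ≠ 0 → (∃ i, ¬ Function.Injective (g i)) →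
      (∀ i, Module.finrank k (LinearMap.range (g i)) ≤
        Module.finrank k (LinearMap.range (h i))) →
      ∀ i, Module.finrank k (LinearMap.range (g i)) =
        Module.finrank k (LinearMap.range (h i)) := by
    intro g h1 h2 h3 h4 i
    have h5 := Nat.find_min' hP ⟨g, h1, h2, h3, rfl⟩
    rw [← hN] at h5
    have h6 := (Finset.sum_eq_sum_iff_of_le (fun i _ => h4 i)).1
      (le_antisymm (Finset.sum_le_sum fun i _ => h4 i) h5)
    exact h6 i (Finset.mem_univ i)
  have hh' := mem_repHom.1 hh
  have hcomp : (fun i => h i ∘ₗ h i) ∈ repHom f f := by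
    rw [mem_repHom]
    intro i j a x
    simp [hh']
  have hsq : ∀ i x, h i (h i x) = 0 := by
    refine hf.comp_self_eq_zero hh h0 hi₀ fun hne i => (hmin _ hcomp hne ⟨i₀, fun hinj => ?_⟩
      (fun i => Submodule.finrank_mono (LinearMap.range_comp_le_range _ _)) i).ge
    exact hi₀ (Function.Injective.of_comp (f := h i₀) (by simpa using hinj))
  have hIK : ∀ i, LinearMap.range (h i) ≤ LinearMap.ker (h i) := by
    rintro i _ ⟨x, rfl⟩
    exact hsq i x
  obtain ⟨i₂, hi₂⟩ : ∃ i, LinearMap.range (h i) ≠ ⊥ := by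
    by_contra! hb
    exact h0 (funext fun i => LinearMap.range_eq_bot.1 (hb i))
  obtain ⟨U, W, hU, hW, hd, hs, ⟨i₁, hi₁⟩, hind⟩ := exists_indecomposable_summand (f := f)
    (I := fun i => LinearMap.range (h i)) (K := fun i => LinearMap.ker (h i))
    (fun i j a x hx => by
      rw [LinearMap.mem_ker] at hx ⊢
      rw [← hh', hx, map_zero]) hIK ⟨i₂, hi₂⟩
  have hUK : ∀ i, ∀ x ∈ U i, h i x = 0 := fun i x hx =>
    (hs i ▸ (le_sup_left : U i ≤ U i ⊔ W i)) hx
  have hsurj := ih U hU hind ⟨i₂, fun htop => hi₂ (by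
    rw [LinearMap.range_eq_bot]
    ext x
    exact hUK i₂ x (htop ▸ Submodule.mem_top))⟩
  -- a linear retraction onto `U` killing `W`
  have hr : ∀ i, ∃ r : X i →ₗ[k] U i, (∀ x : U i, r x = x) ∧ ∀ x ∈ W i, r x = 0 := by
    intro i
    obtain ⟨W', hWW', hc⟩ := (hd i).symm.exists_isCompl
    refine ⟨(U i).projectionOnto W' hc.symm, fun x => Submodule.projectionOnto_apply_left _ x,
      fun x hx => (Submodule.projectionOnto_apply_eq_zero_iff _).2 (hWW' hx)⟩
  choose r hrU hrW using hr
  have hrf : ∀ (i j : V) (a : i ⟶ j) (x : X i), h i x = 0 →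
      f i j a (r i x : X i) = (r j (f i j a x) : X j) := by
    intro i j a x hx
    obtain ⟨y, hy, z, hz, rfl⟩ := Submodule.mem_sup.1 ((hs i).symm ▸ hx : x ∈ U i ⊔ W i)
    rw [map_add, map_add, map_add, hrW i z hz, hrW j _ (hW i j a z hz), add_zero, add_zero,
      hrU i ⟨y, hy⟩, hrU j ⟨f i j a y, hU i j a y hy⟩]
  have htf : ∀ (i j : V) (a : i ⟶ j) (x : X i),
      f i j a (r i (h i x) : X i) = (r j (h j (f i j a x)) : X j) := by
    intro i j a x
    rw [hrf i j a _ (hsq i x), hh']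
  -- the kernel of the retraction composed with `h` is that of `h`
  have hker : ∀ i x, r i (h i x) = 0 → h i x = 0 := by
    have h1 : (fun i => (U i).subtype ∘ₗ r i ∘ₗ h i) ∈ repHom f f := by
      rw [mem_repHom]
      intro i j a x
      exact htf i j a x
    have h2 : (fun i => (U i).subtype ∘ₗ r i ∘ₗ h i) ≠ 0 := by
      intro hz
      apply hi₁
      rintro _ ⟨x, rfl⟩
      obtain ⟨y, hy, z, hz', hyz⟩ :=
        Submodule.mem_sup.1 ((hs i₁).symm ▸ hsq i₁ x : h i₁ x ∈ U i₁ ⊔ W i₁)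
      have h3 := LinearMap.congr_fun (congrFun hz i₁) x
      have h4 : ((r i₁ (h i₁ x) : U i₁) : X i₁) = 0 := h3
      rw [← hyz, map_add, hrW i₁ z hz', add_zero, hrU i₁ ⟨y, hy⟩] at h4
      simp only at h4
      rw [← hyz, h4, zero_add]
      exact hz'
    have h5 := hmin _ h1 h2 ⟨i₀, fun hinj => hi₀ (by
        refine Function.Injective.of_comp (f := fun x => ((r i₀ x : U i₀) : X i₀)) ?_
        exact hinj)⟩ (fun i => by
        rw [← LinearMap.comp_assoc, LinearMap.range_comp]
        exact Submodule.finrank_map_le _ _)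
    intro i
    have hk : LinearMap.ker (h i) = LinearMap.ker ((U i).subtype ∘ₗ r i ∘ₗ h i) := by
      refine Submodule.eq_of_le_of_finrank_eq (fun x hx => ?_) ?_
      · rw [LinearMap.mem_ker] at hx ⊢
        simp [hx]
      · have e1 := (h i).finrank_range_add_finrank_ker
        have e2 := ((U i).subtype ∘ₗ r i ∘ₗ h i).finrank_range_add_finrank_ker
        rw [h5 i] at e2
        omega
    intro x hx
    have : x ∈ LinearMap.ker ((U i).subtype ∘ₗ r i ∘ₗ h i) := by
      rw [LinearMap.mem_ker]
      simp [hx]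
    rwa [← hk] at this
  -- correct the retraction
  have hfac : ∀ (i j : V) (a : i ⟶ j), ∃ φ : U i →ₗ[k] U j, ∀ x, φ (r i (h i x)) =
      r j (f i j a x) - restrictRep f U hU i j a (r i x) := by
    intro i j a
    refine exists_factor (r i ∘ₗ h i) (r j ∘ₗ f i j a - restrictRep f U hU i j a ∘ₗ r i)
      fun x hx => ?_
    have := hrf i j a x (hker i x hx)
    rw [LinearMap.sub_apply, sub_eq_zero]
    exact Subtype.ext this.symm
  choose φ hφ using hfac
  -- Adding ψ ∘ r ∘ h to r cancels its failure to commute with the arrows; on U nothing changes,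
  -- because h vanishes there.
  obtain ⟨ψ, hψ⟩ := hsurj φ
  have he : (fun i => (U i).subtype ∘ₗ (r i + ψ i ∘ₗ r i ∘ₗ h i)) ∈ repHom f f := by
    rw [mem_repHom]
    intro i j a x
    have e1 := hφ i j a x
    rw [← hψ, commutatorMap_apply] at e1
    have e2 : restrictRep f U hU i j a (r i (h i x)) = r j (h j (f i j a x)) :=
      Subtype.ext (htf i j a x)
    rw [e2] at e1
    have e3 : restrictRep f U hU i j a (r i x + ψ i (r i (h i x))) =
        r j (f i j a x) + ψ j (r j (h j (f i j a x))) := by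
      rw [map_add, ← sub_eq_zero]
      have := sub_eq_zero.2 e1
      rw [← this]
      abel
    exact congrArg Subtype.val e3
  have hfix : ∀ i (x : U i), (r i + ψ i ∘ₗ r i ∘ₗ h i) (x : X i) = x := by
    intro i x
    simp [hUK i x x.2, hrU]
  rcases hf.2 _ he (fun i x => by
    simp only [LinearMap.comp_apply, Submodule.subtype_apply]
    rw [hfix]) with hz | hid
  · obtain ⟨i, hi⟩ := hind.1
    obtain ⟨x, hx⟩ := exists_ne (0 : U i)
    apply hx
    have h1 := LinearMap.congr_fun (congrFun hz i) (x : X i)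
    simp only [LinearMap.comp_apply, hfix] at h1
    exact Subtype.ext h1
  · apply hi₂
    rw [LinearMap.range_eq_bot]
    ext x
    have h1 := LinearMap.congr_fun (congrFun hid i₂) x
    have h2 : x ∈ U i₂ := by
      rw [LinearMap.id_apply] at h1
      rw [← h1]
      exact ((r i₂ + ψ i₂ ∘ₗ r i₂ ∘ₗ h i₂) x).2
    exact hUK i₂ x h2

/-- Over an algebraically closed field, if the Euler form is positive, then the indecomposable
representations have only scalar endomorphisms, no self-extensions, and dimension vectors at which
the Euler form is `1`. -/
theorem IsIndecomposableRep.scalar_and_surjective [IsAlgClosed k]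
    (hpos : ∀ d : V → ℤ, d ≠ 0 → 0 < eulerForm V d d) {X : V → Type w} [∀ i, AddCommGroup (X i)]
    [∀ i, Module k (X i)] [∀ i, Module.Finite k (X i)] {f : ArrowMaps k X X}
    (hf : IsIndecomposableRep f) :
    (∀ e ∈ repHom f f, ∃ c : k, ∀ i x, e i x = c • x) ∧
      Function.Surjective (commutatorMap f f) ∧
      eulerForm V (dimVector k X) (dimVector k X) = 1 := by
  obtain ⟨N, hN⟩ : ∃ N, ∑ i, Module.finrank k (X i) = N := ⟨_, rfl⟩
  induction N using Nat.strong_induction_on generalizing X with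
  | _ N ih =>
    have hs := scalar_of_surjective_summands f hf fun U hU hind ⟨i, hi⟩ =>
      (ih _ (by
        rw [← hN]
        exact Finset.sum_lt_sum (fun j _ => Submodule.finrank_le _)
          ⟨i, Finset.mem_univ i, Submodule.finrank_lt hi⟩) hind rfl).2.1
    exact ⟨hs, surjective_of_scalar hpos f hf.1 hs⟩

end

/-! ### Extensions and representations with the fewest endomorphisms. -/

section

variable {k : Type*} [Field k] {V : Type u} [Quiver.{v} V]

theorem finrank_map_add_finrank_inf_ker {M M' : Type*} [AddCommGroup M] [Module k M]
    [AddCommGroup M'] [Module k M'] [Module.Finite k M] (N : Submodule k M) (L : M →ₗ[k] M') :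
    Module.finrank k (N.map L) + Module.finrank k (N ⊓ LinearMap.ker L : Submodule k M) =
      Module.finrank k N := by
  have h := (L.domRestrict N).finrank_range_add_finrank_ker
  rw [LinearMap.range_domRestrict] at h
  rw [← h]
  congr 1
  have e : (LinearMap.ker (L.domRestrict N)).map N.subtype = N ⊓ LinearMap.ker L := by
    ext x
    simp only [Submodule.mem_map, LinearMap.mem_ker, Submodule.mem_inf]
    constructor
    · rintro ⟨y, hy, rfl⟩
      exact ⟨y.2, hy⟩
    · rintro ⟨hx, hx'⟩
      exact ⟨⟨x, hx⟩, hx', rfl⟩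
  rw [← e]
  exact Submodule.finrank_map_subtype_eq _ _

theorem finrank_submodule_prod {M M' : Type*} [AddCommGroup M] [Module k M] [AddCommGroup M']
    [Module k M'] [Module.Finite k M] [Module.Finite k M'] (P : Submodule k M)
    (Q : Submodule k M') :
    Module.finrank k (P.prod Q) = Module.finrank k P + Module.finrank k Q := by
  let e : (P.prod Q : Submodule k (M × M')) ≃ₗ[k] P × Q :=
    { toFun := fun x => (⟨x.1.1, x.2.1⟩, ⟨x.1.2, x.2.2⟩)
      invFun := fun x => ⟨(x.1, x.2), x.1.2, x.2.2⟩
      map_add' := fun _ _ => rfl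
      map_smul' := fun _ _ => rfl }
  rw [e.finrank_eq, Module.finrank_prod]

section

variable {A B C D : V → Type*} [∀ i, AddCommGroup (A i)] [∀ i, Module k (A i)]
  [∀ i, AddCommGroup (B i)] [∀ i, Module k (B i)] [∀ i, AddCommGroup (C i)] [∀ i, Module k (C i)]
  [∀ i, AddCommGroup (D i)] [∀ i, Module k (D i)]

/-- Composition with fixed families of linear maps on both sides. -/
def sandwich (p : ∀ i, B i →ₗ[k] C i) (q : ∀ i, D i →ₗ[k] A i) :
    (∀ i, A i →ₗ[k] B i) →ₗ[k] (∀ i, D i →ₗ[k] C i) where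
  toFun h := fun i => p i ∘ₗ h i ∘ₗ q i
  map_add' h h' := by
    funext i
    ext x
    simp
  map_smul' c h := by
    funext i
    ext x
    simp

/-- The extension of two representations given by a cocycle. -/
def extensionRep (f : ArrowMaps k A A) (g : ArrowMaps k B B) (φ : ArrowMaps k A B) :
    ArrowMaps k (fun i => A i × B i) (fun i => A i × B i) :=
  fun i j a => (f i j a ∘ₗ LinearMap.fst k _ _).prod
    (φ i j a ∘ₗ LinearMap.fst k _ _ + g i j a ∘ₗ LinearMap.snd k _ _)

theorem extensionRep_apply (f : ArrowMaps k A A) (g : ArrowMaps k B B) (φ : ArrowMaps k A B)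
    {i j : V} (a : i ⟶ j) (x : A i) (y : B i) :
    extensionRep f g φ i j a (x, y) = (f i j a x, φ i j a x + g i j a y) := rfl

variable [Finite V] [∀ i, Module.Finite k (A i)] [∀ i, Module.Finite k (B i)]

/-- The middle term of a nonsplit extension has fewer endomorphisms than the direct sum. -/
theorem finrank_end_extensionRep_lt (f : ArrowMaps k A A) (g : ArrowMaps k B B)
    (φ : ArrowMaps k A B) (hφ : φ ∉ LinearMap.range (commutatorMap f g)) :
    Module.finrank k (repHom (extensionRep f g φ) (extensionRep f g φ)) <
      Module.finrank k (repHom f f) + Module.finrank k (repHom g g) +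
        Module.finrank k (repHom g f) + Module.finrank k (repHom f g) := by
  set N₀ := repHom (extensionRep f g φ) (extensionRep f g φ) with hN₀
  have hmem : ∀ h ∈ N₀, ∀ (i j : V) (a : i ⟶ j) (x : A i) (y : B i),
      extensionRep f g φ i j a (h i (x, y)) = h j (f i j a x, φ i j a x + g i j a y) := by
    intro h hh i j a x y
    exact mem_repHom.1 hh i j a (x, y)
  -- Endomorphisms of the extension are filtered by their blocks: B → A, then the two diagonal ones,
  -- then A → B. Each block is a morphism once the preceding ones vanish.
  let L₁ : (∀ i, (A i × B i) →ₗ[k] (A i × B i)) →ₗ[k] (∀ i, B i →ₗ[k] A i) :=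
    sandwich (fun i => LinearMap.fst k _ _) (fun i => LinearMap.inr k _ _)
  let L₂ : (∀ i, (A i × B i) →ₗ[k] (A i × B i)) →ₗ[k]
      (∀ i, A i →ₗ[k] A i) × (∀ i, B i →ₗ[k] B i) :=
    (sandwich (fun i => LinearMap.fst k _ _) (fun i => LinearMap.inl k _ _)).prod
      (sandwich (fun i => LinearMap.snd k _ _) (fun i => LinearMap.inr k _ _))
  let L₃ : (∀ i, (A i × B i) →ₗ[k] (A i × B i)) →ₗ[k] (∀ i, A i →ₗ[k] B i) :=
    sandwich (fun i => LinearMap.snd k _ _) (fun i => LinearMap.inl k _ _)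
  set N₁ := N₀ ⊓ LinearMap.ker L₁ with hN₁
  set N₂ := N₁ ⊓ LinearMap.ker L₂ with hN₂
  have hL₁ : ∀ h ∈ LinearMap.ker L₁, ∀ i (y : B i), (h i (0, y)).1 = 0 := fun h hh i y =>
    LinearMap.congr_fun (congrFun (LinearMap.mem_ker.1 hh) i) y
  have hsplit : ∀ (h : ∀ i, (A i × B i) →ₗ[k] (A i × B i)) i (x : A i) (y : B i),
      h i (x, y) = h i (x, 0) + h i (0, y) := fun h i x y => by
    rw [← map_add]; simp
  have e₁ := finrank_map_add_finrank_inf_ker N₀ L₁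
  have e₂ := finrank_map_add_finrank_inf_ker N₁ L₂
  have e₃ := finrank_map_add_finrank_inf_ker N₂ L₃
  have i₁ : N₀.map L₁ ≤ repHom g f := by
    rintro _ ⟨h, hh, rfl⟩
    rw [mem_repHom]
    intro i j a y
    have := congrArg Prod.fst (hmem h hh i j a 0 y)
    rw [map_zero, map_zero, zero_add] at this
    exact this
  have i₂ : N₁.map L₂ < (repHom f f).prod (repHom g g) := by
    refine lt_of_le_of_ne ?_ fun heq => ?_
    · rintro _ ⟨h, ⟨hh, hh₁⟩, rfl⟩
      have h0 := hL₁ h hh₁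
      refine Submodule.mem_prod.2 ⟨mem_repHom.2 fun i j a x => ?_, mem_repHom.2 fun i j a y => ?_⟩
      · have := congrArg Prod.fst (hmem h hh i j a x 0)
        rw [map_zero, add_zero, hsplit h j, Prod.fst_add, h0, add_zero] at this
        exact this
      · have := congrArg Prod.snd (hmem h hh i j a 0 y)
        rw [map_zero, map_zero, zero_add, ← Prod.mk.eta (p := h i (0, y)), h0,
          extensionRep_apply, map_zero, map_zero, zero_add] at this
        exact this
    -- The inclusion of the diagonal part is strict: an endomorphism with diagonal blocks 0 on A and
    -- the identity on B would exhibit φ as a commutator through its block A → B.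
    · have hid : ((0, fun _ => LinearMap.id) : (∀ i, A i →ₗ[k] A i) × (∀ i, B i →ₗ[k] B i)) ∈
          N₁.map L₂ := by
        rw [heq]
        exact Submodule.mem_prod.2 ⟨Submodule.zero_mem _, id_mem_repHom g⟩
      obtain ⟨h, ⟨hh, hh₁⟩, hL⟩ := hid
      have h0 := hL₁ h hh₁
      have ha : ∀ i (x : A i), (h i (x, 0)).1 = 0 := fun i x =>
        LinearMap.congr_fun (congrFun (congrArg Prod.fst hL) i) x
      have hb : ∀ i (y : B i), (h i (0, y)).2 = y := fun i y =>
        LinearMap.congr_fun (congrFun (congrArg Prod.snd hL) i) y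
      refine hφ ⟨L₃ h, ?_⟩
      funext i j a
      ext x
      rw [commutatorMap_apply]
      have := congrArg Prod.snd (hmem h hh i j a x 0)
      rw [map_zero, add_zero, hsplit h j, Prod.snd_add, hb, ← Prod.mk.eta (p := h i (x, 0)), ha,
        extensionRep_apply, map_zero, map_zero, zero_add] at this
      exact sub_eq_of_eq_add' this
  have i₃ : N₂.map L₃ ≤ repHom f g := by
    rintro _ ⟨h, ⟨⟨hh, hh₁⟩, hh₂⟩, rfl⟩
    have ha : ∀ i (x : A i), (h i (x, 0)).1 = 0 := fun i x =>
      LinearMap.congr_fun (congrFun (congrArg Prod.fst (LinearMap.mem_ker.1 hh₂)) i) x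
    have hb : ∀ i (y : B i), (h i (0, y)).2 = 0 := fun i y =>
      LinearMap.congr_fun (congrFun (congrArg Prod.snd (LinearMap.mem_ker.1 hh₂)) i) y
    rw [mem_repHom]
    intro i j a x
    have := congrArg Prod.snd (hmem h hh i j a x 0)
    rw [map_zero, add_zero, hsplit h j, Prod.snd_add, hb, ← Prod.mk.eta (p := h i (x, 0)), ha,
      extensionRep_apply, map_zero, map_zero, zero_add, add_zero] at this
    exact this
  have i₄ : N₂ ⊓ LinearMap.ker L₃ = ⊥ := by
    rw [eq_bot_iff]
    rintro h ⟨⟨⟨-, hh₁⟩, hh₂⟩, hh₃⟩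
    have h0 := hL₁ h hh₁
    have ha : ∀ i (x : A i), (h i (x, 0)).1 = 0 := fun i x =>
      LinearMap.congr_fun (congrFun (congrArg Prod.fst (LinearMap.mem_ker.1 hh₂)) i) x
    have hb : ∀ i (y : B i), (h i (0, y)).2 = 0 := fun i y =>
      LinearMap.congr_fun (congrFun (congrArg Prod.snd (LinearMap.mem_ker.1 hh₂)) i) y
    have hc : ∀ i (x : A i), (h i (x, 0)).2 = 0 := fun i x =>
      LinearMap.congr_fun (congrFun (LinearMap.mem_ker.1 hh₃) i) x
    rw [Submodule.mem_bot]
    funext i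
    refine LinearMap.ext fun ⟨x, y⟩ => ?_
    rw [hsplit]
    exact Prod.ext (by simp [ha, h0]) (by simp [hb, hc])
  have d₁ := Submodule.finrank_mono i₁
  have d₂ := Submodule.finrank_lt_finrank_of_lt i₂
  have d₃ := Submodule.finrank_mono i₃
  rw [finrank_submodule_prod] at d₂
  rw [i₄, finrank_bot] at e₃
  rw [← hN₁] at e₁
  rw [← hN₂] at e₂
  omega

end

section

variable {X : V → Type*} [∀ i, AddCommGroup (X i)] [∀ i, Module k (X i)]
  [∀ i, Module.Finite k (X i)] [Finite V]

/-- The endomorphisms of a direct sum contain the four spaces of morphisms between the summands. -/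
theorem finrank_hom_summands_le (f : ArrowMaps k X X) {U W : ∀ i, Submodule k (X i)}
    (hU : ∀ (i j : V) (a : i ⟶ j), ∀ x ∈ U i, f i j a x ∈ U j)
    (hW : ∀ (i j : V) (a : i ⟶ j), ∀ x ∈ W i, f i j a x ∈ W j)
    (hc : ∀ i, IsCompl (U i) (W i)) :
    Module.finrank k (repHom (restrictRep f U hU) (restrictRep f U hU)) +
      Module.finrank k (repHom (restrictRep f W hW) (restrictRep f W hW)) +
      Module.finrank k (repHom (restrictRep f W hW) (restrictRep f U hU)) +
      Module.finrank k (repHom (restrictRep f U hU) (restrictRep f W hW)) ≤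
    Module.finrank k (repHom f f) := by
  let ιU : ∀ i, U i →ₗ[k] X i := fun i => (U i).subtype
  let ιW : ∀ i, W i →ₗ[k] X i := fun i => (W i).subtype
  let pU : ∀ i, X i →ₗ[k] U i := fun i => (U i).projectionOnto (W i) (hc i)
  let pW : ∀ i, X i →ₗ[k] W i := fun i => (W i).projectionOnto (U i) (hc i).symm
  have hUU : ∀ i x, pU i (ιU i x) = x := fun i x => Submodule.projectionOnto_apply_left (hc i) x
  have hWW : ∀ i x, pW i (ιW i x) = x := fun i x =>
    Submodule.projectionOnto_apply_left (hc i).symm x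
  have hUW : ∀ i x, pU i (ιW i x) = 0 := fun i x => Submodule.projectionOnto_apply_right (hc i) x
  have hWU : ∀ i x, pW i (ιU i x) = 0 := fun i x =>
    Submodule.projectionOnto_apply_right (hc i).symm x
  have ιU_hom : ∀ (i j : V) (a : i ⟶ j) (x : U i),
      f i j a (ιU i x) = ιU j (restrictRep f U hU i j a x) := fun _ _ _ _ => rfl
  have ιW_hom : ∀ (i j : V) (a : i ⟶ j) (x : W i),
      f i j a (ιW i x) = ιW j (restrictRep f W hW i j a x) := fun _ _ _ _ => rfl
  have hdec : ∀ i (x : X i), ∃ (y : U i) (z : W i), x = ιU i y + ιW i z := fun i x => by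
    obtain ⟨y, hy, z, hz, rfl⟩ := Submodule.mem_sup.1
      (((hc i).sup_eq_top ▸ Submodule.mem_top : x ∈ U i ⊔ W i))
    exact ⟨⟨y, hy⟩, ⟨z, hz⟩, rfl⟩
  have pU_hom : ∀ (i j : V) (a : i ⟶ j) (x : X i),
      pU j (f i j a x) = restrictRep f U hU i j a (pU i x) := fun i j a x => by
    obtain ⟨y, z, rfl⟩ := hdec i x
    simp only [map_add, ιU_hom, ιW_hom, hUU, hUW, map_zero]
  have pW_hom : ∀ (i j : V) (a : i ⟶ j) (x : X i),
      pW j (f i j a x) = restrictRep f W hW i j a (pW i x) := fun i j a x => by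
    obtain ⟨y, z, rfl⟩ := hdec i x
    simp only [map_add, ιU_hom, ιW_hom, hWW, hWU, map_zero]
  let S := (repHom (restrictRep f U hU) (restrictRep f U hU)).prod
    ((repHom (restrictRep f W hW) (restrictRep f W hW)).prod
      ((repHom (restrictRep f W hW) (restrictRep f U hU)).prod
        (repHom (restrictRep f U hU) (restrictRep f W hW))))
  let Θ : ((∀ i, U i →ₗ[k] U i) × (∀ i, W i →ₗ[k] W i) × (∀ i, W i →ₗ[k] U i) ×
      (∀ i, U i →ₗ[k] W i)) →ₗ[k] (∀ i, X i →ₗ[k] X i) :=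
    (sandwich ιU pU).coprod ((sandwich ιW pW).coprod ((sandwich ιU pW).coprod (sandwich ιW pU)))
  have hΘ : ∀ α β γ η i x, Θ (α, β, γ, η) i x = ιU i (α i (pU i x)) + (ιW i (β i (pW i x)) +
      (ιU i (γ i (pW i x)) + ιW i (η i (pU i x)))) := fun _ _ _ _ _ _ => rfl
  have hinj : Function.Injective Θ := by
    rw [← LinearMap.ker_eq_bot, eq_bot_iff]
    rintro ⟨α, β, γ, η⟩ h0
    have h1 : ∀ i x, ιU i (α i (pU i x)) + (ιW i (β i (pW i x)) +
        (ιU i (γ i (pW i x)) + ιW i (η i (pU i x)))) = 0 := fun i x =>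
      LinearMap.congr_fun (congrFun (LinearMap.mem_ker.1 h0) i) x
    rw [Submodule.mem_bot]
    refine Prod.ext ?_ (Prod.ext ?_ (Prod.ext ?_ ?_))
    · funext i
      ext1 x
      have := congrArg (pU i) (h1 i (ιU i x))
      simp only [map_add, hUU, hUW, hWU, map_zero, add_zero, zero_add] at this
      exact this
    · funext i
      ext1 x
      have := congrArg (pW i) (h1 i (ιW i x))
      simp only [map_add, hUW, hWU, hWW, map_zero, add_zero, zero_add] at this
      exact this
    · funext i
      ext1 x
      have := congrArg (pU i) (h1 i (ιW i x))
      simp only [map_add, hUU, hUW, hWW, map_zero, add_zero, zero_add] at this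
      exact this
    · funext i
      ext1 x
      have := congrArg (pW i) (h1 i (ιU i x))
      simp only [map_add, hUU, hWU, hWW, map_zero, zero_add] at this
      exact this
  have hmap : S.map Θ ≤ repHom f f := by
    rintro _ ⟨⟨α, β, γ, η⟩, ⟨hα, hβ, hγ, hη⟩, rfl⟩
    have hα := mem_repHom.1 hα
    have hβ := mem_repHom.1 hβ
    have hγ := mem_repHom.1 hγ
    have hη := mem_repHom.1 hη
    rw [mem_repHom]
    intro i j a x
    simp only at hα hβ hγ hη
    simp only [hΘ, map_add, ιU_hom, ιW_hom, pU_hom, pW_hom, hα, hβ, hγ, hη]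
  have hle := Submodule.finrank_mono hmap
  have heq : Module.finrank k (S.map Θ) = Module.finrank k S :=
    (Submodule.equivMapOfInjective Θ hinj S).finrank_eq.symm
  rw [heq] at hle
  simp only [S] at hle
  rw [finrank_submodule_prod, finrank_submodule_prod, finrank_submodule_prod] at hle
  omega

end

variable [Fintype V] [∀ i j : V, Finite (i ⟶ j)]

omit [∀ i j : V, Finite (i ⟶ j)] in
/-- A representation with the fewest endomorphisms among those of its dimension vector has no
extensions between complementary summands. -/
theorem surjective_of_minimal {X : V → Type w} [∀ i, AddCommGroup (X i)] [∀ i, Module k (X i)]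
    [∀ i, Module.Finite k (X i)] (f : ArrowMaps k X X)
    (hmin : ∀ (Y : V → Type w) [∀ i, AddCommGroup (Y i)] [∀ i, Module k (Y i)]
      [∀ i, Module.Finite k (Y i)] (g : ArrowMaps k Y Y), dimVector k Y = dimVector k X →
      Module.finrank k (repHom f f) ≤ Module.finrank k (repHom g g))
    {U W : ∀ i, Submodule k (X i)}
    (hU : ∀ (i j : V) (a : i ⟶ j), ∀ x ∈ U i, f i j a x ∈ U j)
    (hW : ∀ (i j : V) (a : i ⟶ j), ∀ x ∈ W i, f i j a x ∈ W j)
    (hc : ∀ i, IsCompl (U i) (W i)) :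
    Function.Surjective (commutatorMap (restrictRep f U hU) (restrictRep f W hW)) := by
  by_contra hns
  rw [Function.Surjective, not_forall] at hns
  obtain ⟨φ, hφ⟩ := hns
  -- The nonsplit extension has the dimension vector of X but fewer endomorphisms than the direct
  -- sum of the summands, that is, than X.
  have h1 := finrank_end_extensionRep_lt (restrictRep f U hU) (restrictRep f W hW) φ hφ
  have h2 := finrank_hom_summands_le f hU hW hc
  have h3 := hmin (fun i => U i × W i) (extensionRep (restrictRep f U hU) (restrictRep f W hW) φ)
    (funext fun i => by
      simp only [dimVector]
      rw [(Submodule.prodEquivOfIsCompl (U i) (W i) (hc i)).finrank_eq])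
  omega

omit [∀ i j : V, Finite (i ⟶ j)] in
theorem eulerForm_add_add (a b : V → ℤ) :
    eulerForm V (a + b) (a + b) =
      eulerForm V a a + eulerForm V b b + eulerForm V a b + eulerForm V b a := by
  simp only [eulerForm, Pi.add_apply, add_mul, mul_add, Finset.sum_add_distrib]
  ring

/-- A representation with the fewest endomorphisms among those of its dimension vector is
indecomposable if the (positive) Euler form takes the value `1` at this vector. -/
theorem isIndecomposableRep_of_minimal (hpos : ∀ d : V → ℤ, d ≠ 0 → 0 < eulerForm V d d)
    {X : V → Type w} [∀ i, AddCommGroup (X i)] [∀ i, Module k (X i)]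
    [∀ i, Module.Finite k (X i)] (f : ArrowMaps k X X)
    (hmin : ∀ (Y : V → Type w) [∀ i, AddCommGroup (Y i)] [∀ i, Module k (Y i)]
      [∀ i, Module.Finite k (Y i)] (g : ArrowMaps k Y Y), dimVector k Y = dimVector k X →
      Module.finrank k (repHom f f) ≤ Module.finrank k (repHom g g))
    (hq : eulerForm V (dimVector k X) (dimVector k X) = 1) : IsIndecomposableRep f := by
  refine ⟨?_, fun e he hee => ?_⟩
  · by_contra! hc
    have : dimVector k X = 0 := funext fun i => by
      have := hc i
      simp [dimVector, Module.finrank_zero_of_subsingleton]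
    rw [this] at hq
    simp [eulerForm] at hq
  have he' := mem_repHom.1 he
  have hid : ∀ i, IsIdempotentElem (e i) := fun i => LinearMap.ext (hee i)
  have hc : ∀ i, IsCompl (LinearMap.range (e i)) (LinearMap.ker (e i)) := fun i =>
    LinearMap.IsIdempotentElem.isCompl (hid i)
  have hU : ∀ (i j : V) (a : i ⟶ j), ∀ x ∈ LinearMap.range (e i),
      f i j a x ∈ LinearMap.range (e j) := by
    rintro i j a _ ⟨x, rfl⟩
    exact ⟨_, (he' i j a x).symm⟩
  have hW : ∀ (i j : V) (a : i ⟶ j), ∀ x ∈ LinearMap.ker (e i),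
      f i j a x ∈ LinearMap.ker (e j) := by
    intro i j a x hx
    rw [LinearMap.mem_ker] at hx ⊢
    rw [← he', hx, map_zero]
  have s₁ := (surjective_commutatorMap_iff _ _).1
    (surjective_of_minimal f hmin (U := fun i => LinearMap.range (e i))
      (W := fun i => LinearMap.ker (e i)) hU hW hc)
  have s₂ := (surjective_commutatorMap_iff _ _).1
    (surjective_of_minimal f hmin (W := fun i => LinearMap.range (e i))
      (U := fun i => LinearMap.ker (e i)) hW hU (fun i => (hc i).symm))
  have hsum : dimVector k X = dimVector k (fun i => LinearMap.range (e i)) +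
      dimVector k (fun i => LinearMap.ker (e i)) := funext fun i => by
    simp only [dimVector, Pi.add_apply]
    exact_mod_cast (e i).finrank_range_add_finrank_ker.symm
  -- The mixed terms are now dimensions of Hom spaces, hence nonnegative, while each nonzero summand
  -- contributes at least 1.
  rw [hsum, eulerForm_add_add, ← s₁, ← s₂] at hq
  have hz : dimVector k (fun i => LinearMap.range (e i)) = 0 ∨
      dimVector k (fun i => LinearMap.ker (e i)) = 0 := by
    by_contra! hne
    have h1 := hpos _ hne.1
    have h2 := hpos _ hne.2
    omega
  refine hz.imp (fun h => funext fun i => ?_) (fun h => funext fun i => ?_)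
  · have := congrFun h i
    simp only [dimVector, Pi.zero_apply, Nat.cast_eq_zero, Submodule.finrank_eq_zero] at this
    exact LinearMap.range_eq_bot.1 this
  · have := congrFun h i
    simp only [dimVector, Pi.zero_apply, Nat.cast_eq_zero, Submodule.finrank_eq_zero] at this
    ext x
    have h1 : e i x - x ∈ LinearMap.ker (e i) := by
      rw [LinearMap.mem_ker, map_sub, hee, sub_self]
    rw [this, Submodule.mem_bot, sub_eq_zero] at h1
    exact h1

end

/-- Every nonnegative vector at which the positive Euler form is `1` is the dimension vector of an
indecomposable representation. -/
theorem exists_indecomposable_of_eulerForm_eq_one (k : Type w) [Field k] {V : Type u}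
    [Quiver.{v} V] [Fintype V] [∀ i j : V, Finite (i ⟶ j)]
    (hpos : ∀ d : V → ℤ, d ≠ 0 → 0 < eulerForm V d d) {d : V → ℤ} (h0 : 0 ≤ d)
    (hd : eulerForm V d d = 1) :
    ∃ (X : V → ModuleCat.{w} k) (_ : ∀ i, Module.Finite k (X i))
      (f : ArrowMaps k (fun i => X i) (fun i => X i)),
      dimVector k (fun i => X i) = d ∧ IsIndecomposableRep f := by
  classical
  -- The possible dimensions of the endomorphism space; the representation with zero maps shows that
  -- there is one.
  let P : ℕ → Prop := fun N => ∃ (X : V → ModuleCat.{w} k) (_ : ∀ i, Module.Finite k (X i))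
      (f : ArrowMaps k (fun i => X i) (fun i => X i)),
      dimVector k (fun i => X i) = d ∧ Module.finrank k (repHom f f) = N
  have hP : ∃ N, P N := by
    refine ⟨_, fun i => ModuleCat.of k (Fin (d i).toNat → k), fun i => ?_, 0, ?_, rfl⟩
    · change Module.Finite k (Fin (d i).toNat → k)
      infer_instance
    · funext i
      have : Module.finrank k (Fin (d i).toNat → k) = (d i).toNat := by simp
      simp only [dimVector]
      rw [show Module.finrank k (ModuleCat.of k (Fin (d i).toNat → k)) = (d i).toNat from this,
        Int.toNat_of_nonneg (h0 i)]
  obtain ⟨X, hX, f, hdim, hN⟩ := Nat.find_spec hP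
  refine ⟨X, hX, f, hdim, isIndecomposableRep_of_minimal hpos f ?_ (by rw [hdim, hd])⟩
  intro Y _ _ _ g hY
  rw [hN]
  exact Nat.find_min' hP ⟨fun i => ModuleCat.of k (Y i), ‹_›, g, hY.trans hdim, rfl⟩

/-! ### Vanishing criteria for first extension groups in an abelian category. -/

section

open DerivedCategory Pretriangulated Triangulated Abelian

variable {C : Type u} [Category.{v} C] [Abelian C] [HasExt.{w} C]

/-- First extension groups are effaceable: every class is killed by an epimorphism. -/
theorem exists_epi_comp_eq_zero {X Y : C} (α : Ext X Y 1) :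
    ∃ (E : C) (g : E ⟶ X), Epi g ∧ (Ext.mk₀ g).comp α (zero_add 1) = 0 := by
  let := HasDerivedCategory.standard C
  let a : (singleFunctor C 0).obj X ⟶ ((singleFunctor C 0).obj Y)⟦(1 : ℤ)⟧ := α.hom
  -- The class is a morphism X ⟶ Y⟦1⟧ in the derived category. The middle term of its triangle lies
  -- in degree 0, so it is an object E of `C`, the extension represented by the class.
  obtain ⟨E', f', g', hT⟩ := distinguished_cocone_triangle₂ a
  have h1 : E'.IsLE 0 := TStructure.t.isLE₂ _ hT 0
    (inferInstanceAs (((singleFunctor C 0).obj Y).IsLE 0))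
    (inferInstanceAs (((singleFunctor C 0).obj X).IsLE 0))
  have h2 : E'.IsGE 0 := TStructure.t.isGE₂ _ hT 0
    (inferInstanceAs (((singleFunctor C 0).obj Y).IsGE 0))
    (inferInstanceAs (((singleFunctor C 0).obj X).IsGE 0))
  obtain ⟨E, ⟨e⟩⟩ := exists_iso_singleFunctor_obj_of_isGE_of_isLE E' 0
  obtain ⟨g, hg⟩ := (singleFunctor C 0).map_surjective (e.inv ≫ g')
  refine ⟨E, g, ?_, ?_⟩
  · rw [Preadditive.epi_iff_cancel_zero]
    intro Z h hgh
    have h3 : g' ≫ (singleFunctor C 0).map h = 0 := by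
      rw [← cancel_epi e.inv, ← Category.assoc, ← hg, ← Functor.map_comp, hgh]
      simp
    -- A morphism killed by g' factors through Y⟦1⟧, which sits in degree -1 and has no nonzero map
    -- to an object in degree 0.
    obtain ⟨b, hb⟩ : ∃ b : ((singleFunctor C 0).obj Y)⟦(1 : ℤ)⟧ ⟶ (singleFunctor C 0).obj Z,
        (singleFunctor C 0).map h = a ≫ b := Triangle.yoneda_exact₃ _ hT _ h3
    have hb0 : b = 0 := by
      have h4 : TStructure.t.IsLE (((singleFunctor C 0).obj Y)⟦(1 : ℤ)⟧) (-1) :=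
        TStructure.t.isLE_shift _ 0 1 (-1) (by lia)
      exact TStructure.t.zero b (-1) 0 (by lia)
    apply (singleFunctor C 0).map_injective
    rw [hb, hb0, Functor.map_zero, Limits.comp_zero]
  · ext
    rw [Ext.comp_hom, Ext.mk₀_hom, ShiftedHom.mk₀_comp, Ext.zero_hom, hg, Category.assoc]
    have := comp_distTriang_mor_zero₂₃ _ hT
    change g' ≫ a = 0 at this
    change e.inv ≫ g' ≫ a = 0
    rw [this]
    simp

/-- If every morphism from the kernel of an epimorphism onto `X` to `Y` extends, then there are no
extensions of `X` by `Y`. -/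
theorem subsingleton_ext_one {X Y : C}
    (h : ∀ (S : ShortComplex C), S.ShortExact → S.X₃ = X → ∀ f : S.X₁ ⟶ Y,
      ∃ r : S.X₂ ⟶ Y, S.f ≫ r = f) : Subsingleton (Ext X Y 1) := by
  refine subsingleton_of_forall_eq 0 fun α => ?_
  obtain ⟨E, g, hg, hα⟩ := exists_epi_comp_eq_zero α
  let S := ShortComplex.mk (Limits.kernel.ι g) g (Limits.kernel.condition g)
  have hS : S.ShortExact :=
    { exact := ShortComplex.exact_of_f_is_kernel _ (Limits.kernelIsKernel g)
      mono_f := inferInstanceAs (Mono (Limits.kernel.ι g))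
      epi_g := hg }
  -- By the long exact sequence α is the class of the short exact sequence composed with a map from
  -- the kernel to Y. When that map extends to the middle term, the composite vanishes.
  obtain ⟨φ, hφ⟩ := Ext.contravariant_sequence_exact₃ hS Y α hα (n₀ := 0) (by lia)
  obtain ⟨f, rfl⟩ := (Ext.mk₀_bijective _ _).2 φ
  obtain ⟨r, hr⟩ := h S hS rfl f
  rw [← hφ, ← hr, ← Ext.mk₀_comp_mk₀, hS.extClass_comp_assoc]

end

open CategoryTheory.Limits

/-! ### From functors on the path category to families of linear maps. -/

section

variable {k : Type w} [Field k] {V : Type u} [Quiver.{v} V]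

/-- The linear maps along the arrows of a representation. -/
abbrev arrowMaps (M : QuiverRep k V) :
    ArrowMaps k (fun i : V => M.obj ((Paths.of V).obj i))
      (fun i : V => M.obj ((Paths.of V).obj i)) :=
  fun _ _ a => (M.map ((Paths.of V).map a)).hom

/-- A family of linear maps compatible with the arrows is a natural transformation. -/
def natTransOfRepHom {M N : QuiverRep k V}
    (ψ : ∀ i : V, M.obj ((Paths.of V).obj i) →ₗ[k] N.obj ((Paths.of V).obj i))
    (hψ : ψ ∈ repHom (arrowMaps M) (arrowMaps N)) : M ⟶ N where
  app i := ModuleCat.ofHom (ψ i)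
  naturality i j p := by
    refine Paths.induction (fun {i j} (p : i ⟶ j) => M.map p ≫ ModuleCat.ofHom (ψ j) =
      ModuleCat.ofHom (ψ i) ≫ N.map p) ?_ ?_ p
    · intro i
      exact ((congrArg (· ≫ ModuleCat.ofHom (ψ i)) (M.map_id _)).trans (Category.id_comp _)).trans
        ((congrArg (ModuleCat.ofHom (ψ i) ≫ ·) (N.map_id _)).trans (Category.comp_id _)).symm
    · intro i j l p a h
      have ha : M.map ((Paths.of V).map a) ≫ ModuleCat.ofHom (ψ l) =
          ModuleCat.ofHom (ψ j) ≫ N.map ((Paths.of V).map a) := by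
        ext x
        exact (mem_repHom.1 hψ j l a x).symm
      calc M.map (p ≫ (Paths.of V).map a) ≫ ModuleCat.ofHom (ψ l)
          = M.map p ≫ M.map ((Paths.of V).map a) ≫ ModuleCat.ofHom (ψ l) :=
            (congrArg (· ≫ ModuleCat.ofHom (ψ l)) (M.map_comp _ _)).trans (Category.assoc _ _ _)
        _ = (M.map p ≫ ModuleCat.ofHom (ψ j)) ≫ N.map ((Paths.of V).map a) :=
            (congrArg (M.map p ≫ ·) ha).trans (Category.assoc _ _ _).symm
        _ = (ModuleCat.ofHom (ψ i) ≫ N.map p) ≫ N.map ((Paths.of V).map a) :=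
            congrArg (· ≫ N.map ((Paths.of V).map a)) h
        _ = ModuleCat.ofHom (ψ i) ≫ N.map (p ≫ (Paths.of V).map a) :=
            (Category.assoc _ _ _).trans
              (congrArg (ModuleCat.ofHom (ψ i) ≫ ·) (N.map_comp _ _).symm)

theorem repHom_of_natTrans {M N : QuiverRep k V} (η : M ⟶ N) :
    (fun i : V => (η.app ((Paths.of V).obj i)).hom) ∈ repHom (arrowMaps M) (arrowMaps N) := by
  rw [mem_repHom]
  intro i j a x
  have := η.naturality ((Paths.of V).map a)
  exact (LinearMap.congr_fun (congrArg ModuleCat.Hom.hom this) x).symm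

theorem isZero_iff_forall_subsingleton (M : QuiverRep k V) :
    IsZero M ↔ ∀ i : V, Subsingleton (M.obj ((Paths.of V).obj i)) := by
  rw [Functor.isZero_iff]
  exact forall_congr' fun i => ModuleCat.isZero_iff_subsingleton

/-- Idempotents split in the category of representations, so idempotent endomorphisms correspond to
decompositions as a biproduct. -/
theorem indecomposable_iff (M : QuiverRep k V) :
    Indecomposable M ↔ IsIndecomposableRep (arrowMaps M) := by
  constructor
  · rintro ⟨h0, h⟩
    refine ⟨?_, fun e he hee => ?_⟩
    · rw [isZero_iff_forall_subsingleton] at h0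
      by_contra! hc
      exact h0 hc
    let η : M ⟶ M := natTransOfRepHom e he
    have hη : η ≫ η = η := by
      ext i x
      exact hee i x
    obtain ⟨Y, i, p, hip, hpi⟩ := IsIdempotentComplete.idempotents_split M η hη
    obtain ⟨Z, j, q, hjq, hqj⟩ := IsIdempotentComplete.idempotents_split M (𝟙 M - η)
      (Idempotents.idem_of_id_sub_idem η hη)
    have hiq : i ≫ q = 0 := by
      have : (i ≫ q) ≫ j = 0 := by
        rw [Category.assoc, hqj, Preadditive.comp_sub, Category.comp_id, ← hpi,
          ← Category.assoc, hip, Category.id_comp, sub_self]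
      rw [← Category.comp_id (i ≫ q), ← hjq, ← Category.assoc, this, zero_comp]
    have hjp : j ≫ p = 0 := by
      have : q ≫ (j ≫ p) = 0 := by
        rw [← Category.assoc, hqj, Preadditive.sub_comp, Category.id_comp, ← hpi,
          Category.assoc, hip, Category.comp_id, sub_self]
      rw [← Category.id_comp (j ≫ p), ← hjq, Category.assoc, this, comp_zero]
    let iso : M ≅ Y ⊞ Z :=
      { hom := biprod.lift p q
        inv := biprod.desc i j
        hom_inv_id := by rw [biprod.lift_desc, hpi, hqj]; abel
        inv_hom_id := by
          refine biprod.hom_ext' _ _ (biprod.hom_ext _ _ ?_ ?_) (biprod.hom_ext _ _ ?_ ?_) <;>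
            simp [hip, hjq, hiq, hjp] }
    rcases h Y Z iso with hY | hZ
    · left
      have : η = 0 := by rw [← hpi, hY.eq_of_tgt p 0, zero_comp]
      funext i
      ext x
      exact LinearMap.congr_fun (congrArg ModuleCat.Hom.hom (NatTrans.congr_app this i)) x
    · right
      have : 𝟙 M - η = 0 := by rw [← hqj, hZ.eq_of_tgt q 0, zero_comp]
      have := (sub_eq_zero.1 this).symm
      funext i
      ext x
      exact LinearMap.congr_fun (congrArg ModuleCat.Hom.hom (NatTrans.congr_app this i)) x
  · rintro ⟨h0, h⟩
    refine ⟨fun hz => ?_, fun Y Z iso => ?_⟩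
    · obtain ⟨i, hi⟩ := h0
      exact not_subsingleton _ ((isZero_iff_forall_subsingleton M).1 hz i)
    let η : M ⟶ M := iso.hom ≫ biprod.fst ≫ biprod.inl ≫ iso.inv
    have hη : η ≫ η = η := by simp [η]
    rcases h _ (repHom_of_natTrans η) (fun i x =>
      LinearMap.congr_fun (congrArg ModuleCat.Hom.hom (NatTrans.congr_app hη i)) x) with he | he
    · left
      have h1 : η = 0 := by
        ext i x
        exact LinearMap.congr_fun (congrFun he i) x
      rw [IsZero.iff_id_eq_zero]
      have : 𝟙 Y = biprod.inl ≫ iso.inv ≫ η ≫ iso.hom ≫ biprod.fst := by simp [η]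
      rw [this, h1]
      simp
    · right
      have h1 : η = 𝟙 M := by
        ext i x
        exact LinearMap.congr_fun (congrFun he i) x
      rw [IsZero.iff_id_eq_zero]
      have : 𝟙 Z = biprod.inr ≫ iso.inv ≫ 𝟙 M ≫ iso.hom ≫ biprod.snd := by simp
      rw [this, ← h1]
      simp [η]

/-- If every family of maps along the arrows is a commutator, then there are no extensions. -/
theorem subsingleton_ext_of_surjective [HasExt.{max u v w (w + 1)} (QuiverRep k V)]
    {M N : QuiverRep k V}
    (h : Function.Surjective (commutatorMap (arrowMaps M) (arrowMaps N))) :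
    Subsingleton (Abelian.Ext M N 1) := by
  refine subsingleton_ext_one fun S hS hX f => ?_
  subst hX
  have hSi : ∀ i : V, (S.map ((evaluation (Paths V) (ModuleCat.{w} k)).obj
      ((Paths.of V).obj i))).ShortExact := fun i => hS.map_of_exact _
  have hinj : ∀ i : V, Function.Injective (S.f.app ((Paths.of V).obj i)).hom := fun i =>
    (hSi i).moduleCat_injective_f
  have hex : ∀ (i : V) (x : S.X₂.obj ((Paths.of V).obj i)),
      (S.g.app ((Paths.of V).obj i)).hom x = 0 →
        ∃ y, (S.f.app ((Paths.of V).obj i)).hom y = x := fun i =>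
    (ShortComplex.moduleCat_exact_iff _).1 (hSi i).exact
  -- At each vertex f extends linearly to the middle term. The failure of these extensions to
  -- commute with the arrows vanishes on the subobject, so it descends to the quotient, where it is
  -- a commutator and can be subtracted.
  have hr : ∀ i : V, ∃ r : S.X₂.obj ((Paths.of V).obj i) →ₗ[k] N.obj ((Paths.of V).obj i),
      ∀ x, r ((S.f.app ((Paths.of V).obj i)).hom x) = (f.app ((Paths.of V).obj i)).hom x :=
    fun i => exists_factor _ _ fun x hx => by
      rw [hinj i (hx.trans (map_zero _).symm), map_zero]
  choose r hr using hr
  have hf := mem_repHom.1 (repHom_of_natTrans f)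
  have hSf := mem_repHom.1 (repHom_of_natTrans S.f)
  have hSg := mem_repHom.1 (repHom_of_natTrans S.g)
  have hgf : ∀ (i : V) x, (S.g.app ((Paths.of V).obj i)).hom
      ((S.f.app ((Paths.of V).obj i)).hom x) = 0 := fun i x =>
    LinearMap.congr_fun (congrArg ModuleCat.Hom.hom
      (NatTrans.congr_app S.zero ((Paths.of V).obj i))) x
  have hφ : ∀ (i j : V) (a : i ⟶ j), ∃ φ : S.X₃.obj ((Paths.of V).obj i) →ₗ[k]
      N.obj ((Paths.of V).obj j), ∀ x, φ ((S.g.app ((Paths.of V).obj i)).hom x) =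
        arrowMaps N i j a (r i x) - r j (arrowMaps S.X₂ i j a x) := fun i j a => by
    refine exists_factor _ (arrowMaps N i j a ∘ₗ r i - r j ∘ₗ arrowMaps S.X₂ i j a) fun x hx => ?_
    obtain ⟨y, rfl⟩ := hex i x hx
    rw [LinearMap.sub_apply, LinearMap.comp_apply, LinearMap.comp_apply, hr, sub_eq_zero]
    exact (hf i j a y).trans ((hr j _).symm.trans (congrArg (r j) (hSf i j a y).symm))
  choose φ hφ using hφ
  obtain ⟨ψ, hψ⟩ := h φ
  have hmem : (fun i => r i - ψ i ∘ₗ (S.g.app ((Paths.of V).obj i)).hom) ∈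
      repHom (arrowMaps S.X₂) (arrowMaps N) := by
    rw [mem_repHom]
    intro i j a x
    have e1 := hφ i j a x
    rw [← hψ, commutatorMap_apply] at e1
    have e2 := hSg i j a x
    rw [LinearMap.sub_apply, LinearMap.sub_apply, LinearMap.comp_apply, LinearMap.comp_apply,
      map_sub, ← e2, sub_eq_sub_iff_sub_eq_sub, ← e1]
  have hext : ∀ (i : V) x, (r i - ψ i ∘ₗ (S.g.app ((Paths.of V).obj i)).hom)
      ((S.f.app ((Paths.of V).obj i)).hom x) = (f.app ((Paths.of V).obj i)).hom x := by
    intro i x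
    rw [LinearMap.sub_apply, LinearMap.comp_apply, hgf, hr, map_zero, sub_zero]
  refine ⟨natTransOfRepHom _ hmem, ?_⟩
  ext i x
  exact hext i x

end

/-! ### Gabriel's theorem and the roots of curves. -/

section

variable (k : Type w) [Field k] [IsAlgClosed k] {V : Type u} [DecidableEq V] [Fintype V]
  [Quiver.{v} V] [∀ i j : V, Finite (i ⟶ j)]

theorem realSchurRoots_eq_positiveRoots (hacyclic : IsAcyclic V) (hADE : IsTypeADE V) :
    realSchurRoots k V = positiveRoots V := by
  have hpos : ∀ d : V → ℤ, d ≠ 0 → 0 < eulerForm V d d := fun d hd => by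
    have h1 := (isFiniteCartan hacyclic hADE).form_pos hd
    have h2 := hacyclic.form_eq d
    omega
  ext x
  rw [mem_positiveRoots_iff hacyclic hADE]
  constructor
  · rintro ⟨M, hfin, hind, -, rfl⟩
    have : ∀ i : V, Module.Finite k (M.obj ((Paths.of V).obj i)) := hfin
    exact ⟨fun i => Nat.cast_nonneg _,
      (((indecomposable_iff M).1 hind).scalar_and_surjective hpos).2.2⟩
  · rintro ⟨h0, hx⟩
    obtain ⟨X, hX, f, rfl, hf⟩ := exists_indecomposable_of_eulerForm_eq_one k hpos h0 hx
    let F : V ⥤q ModuleCat.{w} k := { obj := X, map := fun {i j} a => ModuleCat.ofHom (f i j a) }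
    let M : QuiverRep k V := Paths.lift F
    have hM : arrowMaps M = f := by
      funext i j a
      exact congrArg ModuleCat.Hom.hom (Paths.lift_toPath F a)
    refine ⟨M, hX, (indecomposable_iff M).2 ?_, ?_, rfl⟩
    · rw [hM]
      exact hf
    · have := HasExt.standard (QuiverRep k V)
      refine subsingleton_ext_of_surjective ?_
      rw [hM]
      exact (hf.scalar_and_surjective hpos).2.1

-- Spirals for one admissible ordering already reach every positive root, with no change of sign
-- needed.
omit [∀ i j : V, Finite (i ⟶ j)] in
theorem iUnion_associatedRoots_eq_positiveRoots (hacyclic : IsAcyclic V) (hADE : IsTypeADE V) :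
    (⋃ π ∈ admissibleOrderings V, {α : V → ℤ | ∃ γ ∈ nonSelfCrossingCurves (Fintype.card V),
      IsAssociatedRoot π γ α}) = positiveRoots V := by
  ext x
  simp only [mem_iUnion, exists_prop]
  constructor
  · rintro ⟨π, -, γ, -, h⟩
    exact h.mem_positiveRoots hacyclic hADE
  · intro hx
    obtain ⟨h0, hx⟩ := (mem_positiveRoots_iff hacyclic hADE x).1 hx
    have hf := hacyclic.form_eq x
    obtain ⟨π, hπ⟩ := hacyclic.exists_admissibleOrdering
    obtain ⟨k, m, hw⟩ := exists_spiralWord (isFiniteCartan hacyclic hADE) π (by omega) h0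
    obtain ⟨γ, hγ, hγ0, hγw⟩ := exists_spiral_curve k m
    exact ⟨π, hπ, γ, hγ, k, spiralWord k m, hγ0, hγw, Or.inl ⟨hw.symm ▸ h0, hw.symm⟩⟩

end

end LeeLee

theorem corollary3p2 (k : Type w) [Field k] [IsAlgClosed k]
    (V : Type u) [DecidableEq V] [Fintype V] [Quiver.{v} V] [∀ i j : V, Finite (i ⟶ j)]
    (hacyclic : LeeLee.IsAcyclic V) (hADE : LeeLee.IsTypeADE V) :
    (⋃ π ∈ LeeLee.admissibleOrderings V,
        {α : V → ℤ | ∃ γ ∈ LeeLee.nonSelfCrossingCurves (Fintype.card V),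
          LeeLee.IsAssociatedRoot π γ α}) = LeeLee.realSchurRoots k V ∧
      LeeLee.realSchurRoots k V = LeeLee.positiveRoots V :=
  ⟨(LeeLee.iUnion_associatedRoots_eq_positiveRoots hacyclic hADE).trans
    (LeeLee.realSchurRoots_eq_positiveRoots k hacyclic hADE).symm,
    LeeLee.realSchurRoots_eq_positiveRoots k hacyclic hADE⟩
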